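/- **Setting.** All query and host graphs are finite directed multigraphs typed over a type graph $TG$, and a match is a typed graph morphism. For a query subgraph $S$, $\mathcal M_S^{K}$ is the set of matches of $S$ into $K$, and $|m|=|V^S|+|E^S|$ is the size of a match $m$ of $S$. A host graph $H$ is edge-dominated if, for every edge type $e_{TG}$, it has at least as many edges of type $e_{TG}$ as vertices of type $s^{TG}(e_{TG})$, and at least as many as vertices of type $t^{TG}(e_{TG})$. **RETE nets.** A well-formed RETE net $(N,p)$ for a query graph $Q$ without self-loop edges is a binary tree. Its leaves are edge input nodes, each associated with one query edge and its two end vertices. Its inner nodes are join nodes, each associated with the union $Q_l\cup Q_r$ of the query subgraphs of its two dependencies, where $Q_l$ and $Q_r$ share a vertex and both are simpler than (proper subgraphs of) $Q_l\cup Q_r$. The root $p$ is associated with $Q$. A configuration $\mathcal C$ assigns a set of matches to every node. It is consistent if $\mathcal C(n)=\mathcal M_{Q_e}^{H}$ for every edge input $n$ with subgraph $Q_e$, and $\mathcal C(n)=\{m_l\cup m_r \mid m_l\in\mathcal C(n_l),\ m_r\in\mathcal C(n_r),\ m_l|_{Q_l\cap Q_r}=m_r|_{Q_l\cap Q_r}\}$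 for every join $n$ with dependencies $n_l,n_r$. **Localization.** The nodes of the localized net $(N^\Phi,p^\Phi)=localize((N,p))$ hold sets of pairs $(m,\phi)$ of a match and a marking $\phi\in\mathbb N\cup\{\infty\}$. Let $H_p\subseteq H$ be the relevant subgraph. - An edge input for $e:v\to w$ becomes seven nodes: vertex inputs $[v],[w]$ (all matches of the vertex into $H_p$, marked $\infty$); unions $[\cup]_v,[\cup]_w$ over them; a forward navigation node over $[\cup]_v$ and a backward one over $[\cup]_w$ (all matches of $e$ into $H$ whose restriction to $v$, resp. $w$, is a result of the dependency, with its maximal marking); and a union of these two. - A join whose join tree has height $h$ becomes a marking-sensitive join (combining compatible dependency results with the maximum of the markings) and two request projection structures. The structure $RPS_l$ consists of a filter $[\phi>h]$ on the left dependency, a projection to a single vertex $v\in V^{Q_l\cap Q_r}$, and an assignment $[\phi:=h]$. The assignment is added as a dependency of a union $[\cup]_v$ of an arbitrary edge input containing $v$ in the right subtree. $RPS_r$ is the mirror image. - Unions and projections keep the maximal marking of each match. Executing a node replaces its result set by the target result set just described. The sequence $order((N^\Phi,p^\Phi))$ is a reverse topological sorting of the seven nodes if $p$ is an edge input, and if $p$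 is a join it is $$RPS_r,\ order(N^\Phi_l),\ RPS_l,\ order(N^\Phi_r),\ RPS_r,\ order(N^\Phi_l),\ p^\Phi .$$ **Step count.** Nodes are executed incrementally with ideal index structures. A node only handles changes (added matches, increased markings) of its dependencies that occurred since its last execution. The costs are: - being notified of changes by a dependency: $1$ step; nodes whose dependencies have not changed are skipped at no cost, and a vertex input only does work at its first execution; - handling an added dependency match $m$, including the retrieval of adjacent host edges or complementary matches: $|m|$ steps; - constructing a result match $m$, looking it up, and inserting it or increasing its marking: $|m|+1$ steps (also at vertex inputs); - handling an increased marking of a dependency match: $1$ step, plus $1$ step for each associated result match, reached by a stored reference. **Theorem.** There is an absolute constant $K$ such that the following holds. Let $H$ be an edge-dominated graph, $H_p\subseteq H$, $(N,p)$ a well-formed RETE net for a query graph $Q$ without self-loop edges, $\mathcal C$ a consistent configuration for $(N,p)$ and $H$, $(N^\Phi,p^\Phi)=localize((N,p))$ (for any choices made in the construction and any choice of the topological sortings), and $\mathcal C^\Phi_0$ the empty configuration. Then the incremental procedure, run along $order((N^\Phi,p^\Phi))$ from empty result sets, computes $execute(order((N^\Phi,p^\Phi)),N^\Phi,H,H_p,\mathcal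 C^\Phi_0)$ and takes at most $$K\cdot T\cdot(|Q_a|+|Q|)$$ steps, where $T=\sum_{n\in V^N}|\mathcal C(n)|$, $|Q_a|=\frac1T\sum_{n\in V^N}\sum_{m\in\mathcal C(n)}|m|$ is the average size of the matches in $\mathcal C$ (taken as $0$ if $T=0$), and $|Q|=|V^Q|+|E^Q|$. -/

import Mathlib

namespace Rete

/-! ### Graphs, typed graphs, subgraphs -/

/-- A directed multigraph with vertex set `V` and edge set `E`. -/
structure DirGraph (V : Type*) (E : Type*) where
  src : E → V
  tgt : E → V

/-- A graph typed over `TG`: the maps `vtype`, `etype` form a graph morphism into `TG`. -/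
structure TypedGraph {TV TE : Type*} (TG : DirGraph TV TE) (V : Type*) (E : Type*)
    extends DirGraph V E where
  vtype : V → TV
  etype : E → TE
  src_type : ∀ e, vtype (src e) = TG.src (etype e)
  tgt_type : ∀ e, vtype (tgt e) = TG.tgt (etype e)

/-- For every edge type there are at least as many edges of that type as there are vertices of its
source type, and as there are vertices of its target type. -/
def TypedGraph.EdgeDominated {TV TE V E : Type*} {TG : DirGraph TV TE}
    (G : TypedGraph TG V E) : Prop :=
  ∀ eT : TE, max {v : V | G.vtype v = TG.src eT}.ncard {v : V | G.vtype v = TG.tgt eT}.ncard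
    ≤ {e : E | G.etype e = eT}.ncard

structure Subgraph {V E : Type*} (G : DirGraph V E) where
  verts : Set V
  edges : Set E
  src_mem : ∀ e ∈ edges, G.src e ∈ verts
  tgt_mem : ∀ e ∈ edges, G.tgt e ∈ verts

namespace Subgraph

variable {V E : Type*} {G : DirGraph V E}

/-- The whole graph. -/
instance : Top (Subgraph G) := ⟨⟨Set.univ, Set.univ, fun _ _ => trivial, fun _ _ => trivial⟩⟩

/-- The empty subgraph. -/
instance : Bot (Subgraph G) := ⟨⟨∅, ∅, fun _ h => h.elim, fun _ h => h.elim⟩⟩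

/-- Union of subgraphs. -/
instance : Max (Subgraph G) :=
  ⟨fun A B => ⟨A.verts ∪ B.verts, A.edges ∪ B.edges,
    fun e he => he.imp (A.src_mem e) (B.src_mem e),
    fun e he => he.imp (A.tgt_mem e) (B.tgt_mem e)⟩⟩

/-- Intersection of subgraphs. -/
instance : Min (Subgraph G) :=
  ⟨fun A B => ⟨A.verts ∩ B.verts, A.edges ∩ B.edges,
    fun e he => ⟨A.src_mem e he.1, B.src_mem e he.2⟩,
    fun e he => ⟨A.tgt_mem e he.1, B.tgt_mem e he.2⟩⟩⟩

/-- The subgraph consisting of one vertex and no edge. -/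
def ofVertex (G : DirGraph V E) (v : V) : Subgraph G :=
  ⟨{v}, ∅, fun _ h => h.elim, fun _ h => h.elim⟩

/-- The subgraph consisting of one edge and its adjacent vertices. -/
def ofEdge (G : DirGraph V E) (e : E) : Subgraph G :=
  ⟨{G.src e, G.tgt e}, {e}, fun _ h => by cases h; simp, fun _ h => by cases h; simp⟩

end Subgraph

/-! ### Matches -/

/-- A pair of partial maps from the vertices and edges of a query graph to those of a host graph.
A morphism defined on a subgraph `S` of the query graph is such a pair with domain `S`. -/
abbrev PMap (VQ EQ VH EH : Type*) : Type _ := (VQ → Option VH) × (EQ → Option EH)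

namespace PMap

variable {VQ EQ VH EH : Type*} {G : DirGraph VQ EQ}

open Classical in
/-- The restriction `m|_S`. -/
noncomputable def restrict (m : PMap VQ EQ VH EH) (S : Subgraph G) : PMap VQ EQ VH EH :=
  (fun v => if v ∈ S.verts then m.1 v else none, fun e => if e ∈ S.edges then m.2 e else none)

/-- The union of two partial maps (used only for maps that agree on their common domain). -/
def union (m m' : PMap VQ EQ VH EH) : PMap VQ EQ VH EH :=
  (fun v => m.1 v <|> m'.1 v, fun e => m.2 e <|> m'.2 e)

/-- The size `|m|`: the number of vertices plus the number of edges in the domain. -/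
noncomputable def size (m : PMap VQ EQ VH EH) : ℕ :=
  {v | (m.1 v).isSome}.ncard + {e | (m.2 e).isSome}.ncard

end PMap

section Matches

variable {TV TE VQ EQ VH EH : Type*} {TG : DirGraph TV TE}

/-- The set of all matches (typed graph morphisms) from the subgraph `S` of `Q` into the
subgraph `K` of `H`. -/
def allMatches (Q : TypedGraph TG VQ EQ) (H : TypedGraph TG VH EH)
    (S : Subgraph Q.toDirGraph) (K : Subgraph H.toDirGraph) : Set (PMap VQ EQ VH EH) :=
  {m | (∀ v, (m.1 v).isSome ↔ v ∈ S.verts) ∧ (∀ e, (m.2 e).isSome ↔ e ∈ S.edges) ∧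
    (∀ v x, m.1 v = some x → x ∈ K.verts ∧ H.vtype x = Q.vtype v) ∧
    (∀ e y, m.2 e = some y → y ∈ K.edges ∧ H.etype y = Q.etype e ∧
      m.1 (Q.src e) = some (H.src y) ∧ m.1 (Q.tgt e) = some (H.tgt y))}

end Matches

/-! ### Well-formed RETE nets -/

/-- A tree of join nodes over edge input nodes; its root is the production node. -/
inductive JoinTree (E : Type*) where
  | input (e : E)
  | join (l r : JoinTree E)

namespace JoinTree

variable {V E : Type*}

/-- The height of the join tree. -/
def height : JoinTree E → ℕ
  | input _ => 0
  | join l r => max l.height r.height + 1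

/-- The query subgraph associated with the root. -/
def query (G : DirGraph V E) : JoinTree E → Subgraph G
  | input e => Subgraph.ofEdge G e
  | join l r => l.query G ⊔ r.query G

/-- The query subgraphs of the two dependencies of every join share a vertex and are simpler than
(proper subgraphs of) the query subgraph of the join. -/
def WellFormed (G : DirGraph V E) : JoinTree E → Prop
  | input _ => True
  | join l r => l.WellFormed G ∧ r.WellFormed G ∧ (l.query G ⊓ r.query G).verts.Nonempty ∧
      l.query G ≠ l.query G ⊔ r.query G ∧ r.query G ≠ l.query G ⊔ r.query G

/-- The nodes of the tree, addressed by the path from the root (`false`: left, `true`: right). -/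
def nodes : JoinTree E → Finset (List Bool)
  | input _ => {[]}
  | join l r => {[]} ∪ (l.nodes.image (List.cons false) ∪ r.nodes.image (List.cons true))

/-- The subtree whose root is the node with the given address. -/
def subtree : JoinTree E → List Bool → Option (JoinTree E)
  | t, [] => some t
  | input _, _ :: _ => none
  | join l _, false :: p => l.subtree p
  | join _ r, true :: p => r.subtree p

section Standard

variable {TV TE VH EH : Type*} {TG : DirGraph TV TE}

/-- The target result set of a node of the (standard) RETE net in the configuration `C`. -/
def results (t : JoinTree E) (Q : TypedGraph TG V E) (H : TypedGraph TG VH EH)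
    (C : List Bool → Set (PMap V E VH EH)) (p : List Bool) : Set (PMap V E VH EH) :=
  match t.subtree p with
  | none => ∅
  | some (input e) => allMatches Q H (Subgraph.ofEdge Q.toDirGraph e) ⊤
  | some (join l r) =>
      {m | ∃ ml ∈ C (p ++ [false]), ∃ mr ∈ C (p ++ [true]),
        ml.restrict (l.query Q.toDirGraph ⊓ r.query Q.toDirGraph)
          = mr.restrict (l.query Q.toDirGraph ⊓ r.query Q.toDirGraph) ∧ m = ml.union mr}

/-- `C` is a consistent configuration of the RETE net for the host graph `H`. -/
def Consistent (t : JoinTree E) (Q : TypedGraph TG V E) (H : TypedGraph TG VH EH)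
    (C : List Bool → Set (PMap V E VH EH)) : Prop :=
  ∀ p ∈ t.nodes, C p = t.results Q H C p

/-- The total number `T` of matches in a configuration. -/
noncomputable def totalMatches (t : JoinTree E) (C : List Bool → Set (PMap V E VH EH)) : ℕ :=
  ∑ p ∈ t.nodes, (C p).ncard

/-- The average size `|Q_a|` of the matches in a configuration (`0` if there are none). -/
noncomputable def averageMatchSize (t : JoinTree E) (C : List Bool → Set (PMap V E VH EH)) : ℝ :=
  ((∑ p ∈ t.nodes, ∑ᶠ m ∈ C p, m.size : ℕ) : ℝ) / (t.totalMatches C : ℝ)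

end Standard

end JoinTree

/-! ### Marking-sensitive RETE nets -/

/-- The kinds of marking-sensitive RETE nodes, with their dependencies. A `navigation` node is
associated with a single edge and its dependency with one of the two adjacent vertices: it is a
forward navigation node if that vertex is the source, a backward one if it is the target. -/
inductive NodeKind (ι : Type*) where
  | vertexInput
  | union (deps : Finset ι)
  | navigation (dep : ι)
  | projection (dep : ι)
  | assignment (x : ℕ∞) (dep : ι)
  | filter (x : ℕ∞) (dep : ι)
  | join (l r : ι)

/-- A marking-sensitive RETE graph for the query graph `G`: nodes, their kinds and dependencies,
and their associated query subgraphs. -/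
structure MarkingNet {V E : Type*} (G : DirGraph V E) (ι : Type*) where
  nodes : Finset ι
  kind : ι → NodeKind ι
  query : ι → Subgraph G

/-- The set of dependencies of a node. -/
def MarkingNet.deps {V E ι : Type*} {G : DirGraph V E} (N : MarkingNet G ι) (n : ι) : Set ι :=
  match N.kind n with
  | .vertexInput => ∅
  | .union D => D
  | .navigation d => {d}
  | .projection d => {d}
  | .assignment _ d => {d}
  | .filter _ d => {d}
  | .join l r => {l, r}

namespace MarkingNet

variable {TV TE VQ EQ VH EH ι : Type*} {TG : DirGraph TV TE}

/-- The target result set of a marking-sensitive node for host graph `H`, relevant subgraph `Hp`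
and marking-sensitive configuration `C`. -/
def results {Q : TypedGraph TG VQ EQ} (N : MarkingNet Q.toDirGraph ι) (H : TypedGraph TG VH EH)
    (Hp : Subgraph H.toDirGraph) (C : ι → Set (PMap VQ EQ VH EH × ℕ∞)) (n : ι) :
    Set (PMap VQ EQ VH EH × ℕ∞) :=
  match N.kind n with
  | .vertexInput => {a | a.1 ∈ allMatches Q H (N.query n) Hp ∧ a.2 = ⊤}
  | .union D => {a | IsGreatest {φ | ∃ d ∈ D, (a.1, φ) ∈ C d} a.2}
  | .navigation d =>
      {a | a.1 ∈ allMatches Q H (N.query n) ⊤ ∧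
        IsGreatest {φ | (a.1.restrict (N.query d), φ) ∈ C d} a.2}
  | .projection d =>
      {a | ∃ m, a.1 = m.restrict (N.query n) ∧ (m, a.2) ∈ C d ∧
        IsGreatest {φ | ∃ m', (m', φ) ∈ C d ∧ m'.restrict (N.query n) = m.restrict (N.query n)} a.2}
  | .assignment x d => {a | (∃ φ, (a.1, φ) ∈ C d) ∧ a.2 = x}
  | .filter x d => {a | a ∈ C d ∧ x < a.2}
  | .join l r =>
      {a | ∃ b ∈ C l, ∃ c ∈ C r,
        b.1.restrict (N.query l ⊓ N.query r) = c.1.restrict (N.query l ⊓ N.query r) ∧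
        a = (b.1.union c.1, max b.2 c.2)}

open Classical in
/-- The configuration after executing the nodes in the list `O` one after the other: executing a
node replaces its current result set by its target result set. -/
noncomputable def execute {Q : TypedGraph TG VQ EQ} (N : MarkingNet Q.toDirGraph ι)
    (H : TypedGraph TG VH EH) (Hp : Subgraph H.toDirGraph) (O : List ι)
    (C : ι → Set (PMap VQ EQ VH EH × ℕ∞)) : ι → Set (PMap VQ EQ VH EH × ℕ∞) :=
  O.foldl (fun C n => Function.update C n (N.results H Hp C n)) C

/-- `O` lists the nodes in `S` without repetition such that no node precedes one of its
dependencies. -/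
def IsReverseToposort {Q : DirGraph VQ EQ} (N : MarkingNet Q ι) (S : Set ι) (O : List ι) : Prop :=
  O.Nodup ∧ (∀ n, n ∈ O ↔ n ∈ S) ∧ O.Pairwise (fun a b => b ∉ N.deps a)

end MarkingNet

/-! ### Localization -/

/-- The two ends of an edge. -/
inductive EdgeEnd where
  | source
  | target
  deriving DecidableEq

/-- The vertex at the given end of an edge. -/
def DirGraph.endpoint {V E : Type*} (G : DirGraph V E) : EdgeEnd → E → V
  | .source => G.src
  | .target => G.tgt

/-- The role of a node of a localized net. The first four make up the local navigation structure of
an edge input `v → w`: vertex inputs, union nodes above them (the extension points), navigation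
nodes (`source` for `v`, `target` for `w`), and the final union. The others belong to a join: the
join itself and the two request projection structures, where `false` stands for the one fed by the
left dependency and `true` for the one fed by the right dependency. -/
inductive Role where
  | vertexInput (x : EdgeEnd)
  | extension (x : EdgeEnd)
  | navigation (x : EdgeEnd)
  | union
  | join
  | filter (b : Bool)
  | projection (b : Bool)
  | assignment (b : Bool)
  deriving DecidableEq

/-- A node of a localized net: the node of the original net it belongs to, and its role. -/
abbrev LocalNode : Type := List Bool × Role

/-- The choices made for a request projection structure: the vertex it projects to, and the
extension point of the opposite subtree to which it is connected, given by the address of a leaf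
relative to the root of that subtree and by an end of the edge at that leaf. -/
structure Request (V : Type*) where
  vertex : V
  leaf : List Bool
  ending : EdgeEnd

namespace JoinTree

variable {V E : Type*}

/-- The choices are admissible: the vertex lies in the overlap of the two query subgraphs of the
join, and the extension point belongs to a leaf in the opposite subtree and to that vertex. -/
def ValidRequests (t : JoinTree E) (G : DirGraph V E) (req : List Bool → Bool → Request V) : Prop :=
  ∀ p l r, t.subtree p = some (join l r) → ∀ b : Bool,
    (req p b).vertex ∈ (l.query G ⊓ r.query G).verts ∧
    ∃ e, (if b then l else r).subtree (req p b).leaf = some (input e) ∧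
      G.endpoint (req p b).ending e = (req p b).vertex

/-- The node of the localized net that corresponds to the node `p` of the original net. -/
def localRoot (t : JoinTree E) (p : List Bool) : LocalNode :=
  match t.subtree p with
  | some (join _ _) => (p, .join)
  | _ => (p, .union)

/-- The local navigation structure at the leaf `p`. -/
def navigationStructure (p : List Bool) : Finset LocalNode :=
  {(p, .vertexInput .source), (p, .vertexInput .target), (p, .extension .source),
    (p, .extension .target), (p, .navigation .source), (p, .navigation .target), (p, .union)}

/-- The nodes added for the join `p`: the marking-sensitive join and two request projection
structures. -/
def joinStructure (p : List Bool) : Finset LocalNode :=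
  {(p, .join), (p, .filter false), (p, .projection false), (p, .assignment false),
    (p, .filter true), (p, .projection true), (p, .assignment true)}

open Classical in
/-- The marking assignment nodes that are connected to the extension point for the end `x` of the
edge at the leaf `p`. The request projection structure `b` of the join `q` is connected to an
extension point in the subtree `!b` of `q`. -/
noncomputable def requestsAt (t : JoinTree E) (req : List Bool → Bool → Request V)
    (p : List Bool) (x : EdgeEnd) : Finset LocalNode :=
  ((t.nodes ×ˢ (Finset.univ : Finset Bool)).filter fun a =>
    (∃ l r, t.subtree a.1 = some (join l r)) ∧
      a.1 ++ (!a.2) :: (req a.1 a.2).leaf = p ∧ (req a.1 a.2).ending = x).image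
    fun a => (a.1, Role.assignment a.2)

/-- The localized RETE net. Labels of pairs that are not nodes are irrelevant. -/
noncomputable def localize (t : JoinTree E) (G : DirGraph V E)
    (req : List Bool → Bool → Request V) : MarkingNet G LocalNode where
  nodes := t.nodes.biUnion fun p =>
    match t.subtree p with
    | some (input _) => navigationStructure p
    | some (join _ _) => joinStructure p
    | none => ∅
  kind n :=
    match t.subtree n.1, n.2 with
    | some (input _), .vertexInput _ => .vertexInput
    | some (input _), .extension x => .union (insert (n.1, .vertexInput x) (t.requestsAt req n.1 x))
    | some (input _), .navigation x => .navigation (n.1, .extension x)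
    | some (input _), .union => .union {(n.1, .navigation .source), (n.1, .navigation .target)}
    | some (join _ _), .join => .join (t.localRoot (n.1 ++ [false])) (t.localRoot (n.1 ++ [true]))
    | some (join l r), .filter b => .filter (join l r).height (t.localRoot (n.1 ++ [b]))
    | some (join _ _), .projection b => .projection (n.1, .filter b)
    | some (join l r), .assignment b => .assignment (join l r).height (n.1, .projection b)
    | _, _ => .union ∅
  query n :=
    match t.subtree n.1, n.2 with
    | some (input e), .vertexInput x => Subgraph.ofVertex G (G.endpoint x e)
    | some (input e), .extension x => Subgraph.ofVertex G (G.endpoint x e)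
    | some (input e), .navigation _ => Subgraph.ofEdge G e
    | some (input e), .union => Subgraph.ofEdge G e
    | some (join l r), .join => (join l r).query G
    | some (join l r), .filter b => (if b then r else l).query G
    | some (join _ _), .projection b => Subgraph.ofVertex G (req n.1 b).vertex
    | some (join _ _), .assignment b => Subgraph.ofVertex G (req n.1 b).vertex
    | _, _ => ⊥

/-- The reverse topological sorting of the request projection structure `b` of the join `p`. -/
def requestOrder (p : List Bool) (b : Bool) : List LocalNode :=
  [(p, .filter b), (p, .projection b), (p, .assignment b)]

/-- The execution order of the localization of the subtree with root address `p`, where `sort q` is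
a reverse topological sorting of the local navigation structure at the leaf `q`. -/
def order (sort : List Bool → List LocalNode) : JoinTree E → List Bool → List LocalNode
  | input _, p => sort p
  | join l r, p =>
      requestOrder p true ++ l.order sort (p ++ [false]) ++
      requestOrder p false ++ r.order sort (p ++ [true]) ++
      requestOrder p true ++ l.order sort (p ++ [false]) ++ [(p, .join)]

end JoinTree

/-! ### The execution procedure and its step count

Nodes are executed incrementally. Each node keeps its current result set, in which a match has at
most one marking, and a chronological record of the changes to it. Each dependent node remembers how
much of that record it has handled. The elementary operations and their costs are:

* handling a newly added match `m` of a dependency (retrieval in an index): `|m|` steps;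
* constructing a match `m`, looking it up in a result set and inserting it or increasing its
  marking: `|m| + 1` steps;
* handling the increase of the marking of a match of a dependency: `1` step, and `1` more step for
  each associated result match, which is reached by a stored reference;
* being notified by a dependency: `1` step. Nodes without a notification are skipped.
-/

/-- A recorded change of a result set: a match with a marking was added, or the marking of a match
was increased to a new value. -/
inductive Change (M : Type*) where
  | added (m : M) (φ : ℕ∞)
  | raised (m : M) (φ : ℕ∞)

/-- The state of the execution procedure. -/
structure Memory (ι M : Type*) where
  /-- the marking of a match in the current result set of a node, `none` if it is not in there -/
  marking : ι → M → Option ℕ∞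
  /-- the changes of the result set of a node, in chronological order -/
  changes : ι → List (Change M)
  /-- `handled n d`: how many changes of its dependency `d` the node `n` has handled -/
  handled : ι → ι → ℕ
  /-- whether a vertex input node has been executed -/
  loaded : ι → Bool
  /-- the number of steps so far -/
  steps : ℕ

namespace Memory

variable {ι M : Type*}

/-- The initial state: empty result sets, nothing executed. -/
def empty : Memory ι M := ⟨fun _ _ => none, fun _ => [], fun _ _ => 0, fun _ => false, 0⟩

/-- The configuration represented by the state. -/
def config (s : Memory ι M) : ι → Set (M × ℕ∞) := fun n => {a | s.marking n a.1 = some a.2}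

/-- The matches in the current result set of `n`. -/
def stored (s : Memory ι M) (n : ι) : Set M := {m | (s.marking n m).isSome}

/-- Let `k` steps pass. -/
def tick (s : Memory ι M) (k : ℕ) : Memory ι M := { s with steps := s.steps + k }

open Classical in
/-- Set the marking of `m` at node `n` to `φ` and record the change `c`. -/
noncomputable def record (s : Memory ι M) (n : ι) (m : M) (φ : ℕ∞) (c : Change M) : Memory ι M :=
  { s with
    marking := Function.update s.marking n (Function.update (s.marking n) m (some φ))
    changes := Function.update s.changes n (s.changes n ++ [c]) }

open Classical in
/-- Insert `m` with marking `φ` at node `n` if it is not there; otherwise increase its marking to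
`φ` if that is higher. -/
noncomputable def write (s : Memory ι M) (n : ι) (m : M) (φ : ℕ∞) : Memory ι M :=
  match s.marking n m with
  | none => s.record n m φ (.added m φ)
  | some ψ => if ψ < φ then s.record n m φ (.raised m φ) else s

end Memory

open Classical in
/-- A list of the elements of a set, each occurring once. -/
noncomputable def enumerate {α : Type*} [Finite α] (s : Set α) : List α :=
  s.toFinite.toFinset.toList

namespace MarkingNet

variable {TV TE VQ EQ VH EH ι : Type*} {TG : DirGraph TV TE}
  [Finite VQ] [Finite EQ] [Finite VH] [Finite EH]
  {Q : TypedGraph TG VQ EQ}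

open Classical in
/-- The marked results of `n` that arise from a match `m` with marking `φ` that was added to the
result set of the dependency `d`. Navigation nodes retrieve the adjacent edges from `H`, join nodes
the complementary matches from the result set of the other dependency. -/
noncomputable def newResults (N : MarkingNet Q.toDirGraph ι) (H : TypedGraph TG VH EH)
    (s : Memory ι (PMap VQ EQ VH EH)) (n d : ι) (m : PMap VQ EQ VH EH) (φ : ℕ∞) :
    List (PMap VQ EQ VH EH × ℕ∞) :=
  match N.kind n with
  | .vertexInput => []
  | .union _ => [(m, φ)]
  | .navigation _ =>
      (enumerate {m' | m' ∈ allMatches Q H (N.query n) ⊤ ∧ m'.restrict (N.query d) = m}).map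
        fun m' => (m', φ)
  | .projection _ => [(m.restrict (N.query n), φ)]
  | .assignment x _ => [(m, x)]
  | .filter x _ => if x < φ then [(m, φ)] else []
  | .join l r =>
      (enumerate {m' | m' ∈ s.stored (if d = l then r else l) ∧
          m'.restrict (N.query l ⊓ N.query r) = m.restrict (N.query l ⊓ N.query r)}).map
        fun m' => (m.union m', max φ ((s.marking (if d = l then r else l) m').getD 0))

open Classical in
/-- The results of `n` whose marking may have to be increased when the marking of the match `m` in
the result set of the dependency `d` has been increased to `φ`. A filter keeps the matches with a
too low marking aside, with their insertion position, and so reaches these by a reference, too. -/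
noncomputable def associatedResults (N : MarkingNet Q.toDirGraph ι)
    (s : Memory ι (PMap VQ EQ VH EH)) (n d : ι) (m : PMap VQ EQ VH EH) (φ : ℕ∞) :
    List (PMap VQ EQ VH EH) :=
  match N.kind n with
  | .vertexInput => []
  | .union _ => [m]
  | .navigation _ => enumerate {m' | m' ∈ s.stored n ∧ m'.restrict (N.query d) = m}
  | .projection _ => [m.restrict (N.query n)]
  | .assignment _ _ => []
  | .filter x _ => if x < φ then [m] else []
  | .join _ _ => enumerate {m' | m' ∈ s.stored n ∧ m'.restrict (N.query d) = m}

/-- Construct and look up each of the given marked matches, and insert it or adapt its marking. -/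
noncomputable def offerAll (n : ι) (L : List (PMap VQ EQ VH EH × ℕ∞))
    (s : Memory ι (PMap VQ EQ VH EH)) : Memory ι (PMap VQ EQ VH EH) :=
  L.foldl (fun s a => (s.tick (a.1.size + 1)).write n a.1 a.2) s

/-- Adapt the marking of each of the given matches, which are reached by references. -/
noncomputable def raiseAll (n : ι) (L : List (PMap VQ EQ VH EH)) (φ : ℕ∞)
    (s : Memory ι (PMap VQ EQ VH EH)) : Memory ι (PMap VQ EQ VH EH) :=
  L.foldl (fun s m => (s.tick 1).write n m φ) s

/-- Node `n` handles one change of its dependency `d`. -/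
noncomputable def handleChange (N : MarkingNet Q.toDirGraph ι) (H : TypedGraph TG VH EH) (n d : ι)
    (s : Memory ι (PMap VQ EQ VH EH)) :
    Change (PMap VQ EQ VH EH) → Memory ι (PMap VQ EQ VH EH)
  | .added m φ => offerAll n (N.newResults H s n d m φ) (s.tick m.size)
  | .raised m φ => raiseAll n (N.associatedResults s n d m φ) φ (s.tick 1)

open Classical in
/-- Node `n` handles all changes of its dependency `d` that it has not handled yet. -/
noncomputable def handleDep (N : MarkingNet Q.toDirGraph ι) (H : TypedGraph TG VH EH) (n : ι)
    (s : Memory ι (PMap VQ EQ VH EH)) (d : ι) : Memory ι (PMap VQ EQ VH EH) :=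
  let pending := (s.changes d).drop (s.handled n d)
  if pending = [] then s
  else
    pending.foldl (N.handleChange H n d)
      { s.tick 1 with
        handled := Function.update s.handled n
          (Function.update (s.handled n) d (s.changes d).length) }

open Classical in
/-- Execute one node. A vertex input node retrieves the matching vertices of `Hp` when it is
executed for the first time; the other nodes handle the changes of their dependencies. -/
noncomputable def runNode (N : MarkingNet Q.toDirGraph ι) (H : TypedGraph TG VH EH)
    (Hp : Subgraph H.toDirGraph) (s : Memory ι (PMap VQ EQ VH EH)) (n : ι) :
    Memory ι (PMap VQ EQ VH EH) :=
  match N.kind n with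
  | .vertexInput =>
      if s.loaded n then s
      else
        offerAll n ((enumerate (allMatches Q H (N.query n) Hp)).map fun m => (m, ⊤))
          { s with loaded := Function.update s.loaded n true }
  | .union D => D.toList.foldl (N.handleDep H n) s
  | .navigation d => N.handleDep H n s d
  | .projection d => N.handleDep H n s d
  | .assignment _ d => N.handleDep H n s d
  | .filter _ d => N.handleDep H n s d
  | .join l r => N.handleDep H n (N.handleDep H n s l) r

/-- Execute the nodes in the list `O` one after the other, starting with empty result sets. -/
noncomputable def run (N : MarkingNet Q.toDirGraph ι) (H : TypedGraph TG VH EH)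
    (Hp : Subgraph H.toDirGraph) (O : List ι) : Memory ι (PMap VQ EQ VH EH) :=
  O.foldl (N.runNode H Hp) Memory.empty

end MarkingNet

end Rete

/-! There are two independent claims: the incremental procedure computes the right configuration,
and its steps can be charged to matches of the original net.

Correctness. A node knows a dependency only through the prefix of that dependency's change log it
has handled; this prefix defines its view. Two properties hold throughout: every stored marking is
at most the marking of some candidate computed from the current dependencies (soundness), and every
candidate computed from the views is stored with at least its marking (completeness). Both survive
stale information because logs only raise markings and all node kinds are monotone. Once a node has
been executed, its view equals the current dependencies, and the two inequalities force each stored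
marking to be the maximal one (`runNode_config`).

Cost. Charge to each pair of a node and a handled change the cost of handling it, plus one step for
a notification. Steps minus charges never increase (`foldl_runNode_spec`), so the final step count
is at most the total charge, whatever the execution order and however often a node is executed. In a
valid log each match is added once and then raised at most as often as there are markings
(`ValidLog.sum_le`). The only markings are numbers up to the height `h` of the join tree and `∞`.
Every join strictly enlarges its query subgraph and a non-loop edge has size 3, so `h + 2 ≤ |Q|`
(`JoinTree.height_add_three_le`). A match thus carries a charge of order `|m| + |Q|`, which `weight`
sums over a set of matches. The results affected by a change are either at most one match or a fibre
of a restriction map; fibres are disjoint, so each node pays a constant number of weights of itself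
and its dependencies (`MarkingNet.nodeCharge_le`).

Summation. Results in the localized net are matches stored in the original net, their projections to
a vertex, or vertex matches at the leaves (`JoinTree.localize_bounds`). Edge domination bounds the
vertex matches by the edge matches of the same leaf. Each original node is a child of at most one
join, and each request structure feeds one extension point. Hence the total is at most 55 times the
sum of the weights of the original result sets, and this sum is `T · (|Q_a| + |Q|)`
(`JoinTree.sum_weight_eq`). -/

namespace Rete

/-! ### Change logs -/

namespace Change

variable {M : Type*}

/-- The match a change is about. -/
def item : Change M → M
  | added m _ => m
  | raised m _ => m

/-- The marking of the match after the change. -/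
def value : Change M → ℕ∞
  | added _ φ => φ
  | raised _ φ => φ

/-- The change is possible in a result set with markings `f`. -/
def Fits (f : M → Option ℕ∞) : Change M → Prop
  | added m _ => f m = none
  | raised m φ => ∃ ψ, f m = some ψ ∧ ψ < φ

end Change

section Markings

variable {M : Type*}

/-- The marked match `a` occurs in `f` with at least its marking. -/
def Covers (f : M → Option ℕ∞) (a : M × ℕ∞) : Prop := ∃ ψ, f a.1 = some ψ ∧ a.2 ≤ ψ

/-- Every marked match in `f` occurs in `g` with at least its marking. -/
def Dominated (f g : M → Option ℕ∞) : Prop := ∀ m φ, f m = some φ → Covers g (m, φ)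

theorem Dominated.refl (f : M → Option ℕ∞) : Dominated f f := fun _ φ h => ⟨φ, h, le_rfl⟩

theorem Covers.mono {f g : M → Option ℕ∞} {a : M × ℕ∞} (h : Covers f a) (hfg : Dominated f g) :
    Covers g a := by
  obtain ⟨ψ, h1, h2⟩ := h
  obtain ⟨χ, h3, h4⟩ := hfg _ _ h1
  exact ⟨χ, h3, h2.trans h4⟩

theorem Covers.of_le {f : M → Option ℕ∞} {m : M} {φ ψ : ℕ∞} (h : Covers f (m, ψ)) (hle : φ ≤ ψ) :
    Covers f (m, φ) := by
  obtain ⟨χ, h1, h2⟩ := h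
  exact ⟨χ, h1, hle.trans h2⟩

theorem Covers.max {f : M → Option ℕ∞} {m : M} {φ ψ : ℕ∞} (h : Covers f (m, φ))
    (h' : Covers f (m, ψ)) : Covers f (m, max φ ψ) := by
  rcases max_choice φ ψ with e | e <;> rw [e] <;> assumption

theorem Dominated.trans {f g h : M → Option ℕ∞} (hfg : Dominated f g) (hgh : Dominated g h) :
    Dominated f h := fun m φ e => (hfg m φ e).mono hgh

open Classical in
/-- The markings after the changes in the list `L`, starting with an empty result set. -/
noncomputable def replay (L : List (Change M)) : M → Option ℕ∞ :=
  L.foldl (fun f c => Function.update f c.item (some c.value)) fun _ => none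

open Classical in
theorem replay_concat (L : List (Change M)) (c : Change M) :
    replay (L ++ [c]) = Function.update (replay L) c.item (some c.value) := by
  simp [replay]

theorem exists_of_replay_eq_some {L : List (Change M)} {m : M} {φ : ℕ∞}
    (h : replay L m = some φ) : ∃ c ∈ L, c.item = m ∧ c.value = φ := by
  induction L using List.reverseRecOn with
  | nil => simp [replay] at h
  | append_singleton L c ih =>
    rw [replay_concat] at h
    by_cases hm : m = c.item
    · subst hm
      exact ⟨c, by simp, rfl, by simpa using h⟩
    · obtain ⟨c', h1, h2⟩ := ih (by simpa [hm] using h)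
      exact ⟨c', by simp [h1], h2⟩

/-- Every change in the list is possible when it occurs. -/
def ValidLog (L : List (Change M)) : Prop := ∀ L' c, L' ++ [c] <+: L → c.Fits (replay L')

theorem validLog_nil : ValidLog ([] : List (Change M)) := by
  intro L' c h
  simp at h

theorem ValidLog.of_isPrefix {L L' : List (Change M)} (h : ValidLog L) (hp : L' <+: L) :
    ValidLog L' := fun L₁ c hc => h L₁ c (hc.trans hp)

theorem ValidLog.concat {L : List (Change M)} {c : Change M} (h : ValidLog L)
    (hc : c.Fits (replay L)) : ValidLog (L ++ [c]) := by
  intro L' c' hp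
  rcases List.prefix_concat_iff.1 hp with e | hp
  · obtain ⟨h₁, h₂⟩ := List.append_inj' e rfl
    rw [h₁, List.singleton_inj.1 h₂]
    exact hc
  · exact h _ _ hp

-- An addition fills an empty entry and a raise strictly increases one, so no fitting change loses
-- information. This is the source of all monotonicity below.
open Classical in
theorem Change.Fits.dominated {f : M → Option ℕ∞} {c : Change M} (h : c.Fits f) :
    Dominated f (Function.update f c.item (some c.value)) := by
  intro m φ e
  by_cases hm : m = c.item
  · subst hm
    refine ⟨c.value, by simp, ?_⟩
    cases c with
    | added m ψ => simp [Change.Fits, Change.item] at h e; simp [h] at e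
    | raised m ψ =>
      obtain ⟨χ, h1, h2⟩ := h
      simp only [Change.item] at e
      rw [h1] at e
      cases e
      exact h2.le
  · exact ⟨φ, by simp [hm, e], le_rfl⟩

/-- What a node has read from an older prefix is always a lower bound for the current markings, so a
stale view is still usable. -/
theorem ValidLog.replay_dominated {L L' : List (Change M)} (h : ValidLog L) (hp : L' <+: L) :
    Dominated (replay L') (replay L) := by
  induction L using List.reverseRecOn with
  | nil => rw [List.prefix_nil.1 hp]; exact Dominated.refl _
  | append_singleton L c ih =>
    rcases List.prefix_concat_iff.1 hp with e | hp'
    · rw [e]; exact Dominated.refl _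
    · have := (h L c (List.prefix_refl _)).dominated
      rw [replay_concat]
      exact (ih (h.of_isPrefix (List.prefix_append _ _)) hp').trans this

/-- The last change of a valid log is covered by the markings it leads to. -/
theorem ValidLog.covers {L L' : List (Change M)} {c : Change M} (h : ValidLog L)
    (hp : L' ++ [c] <+: L) : Covers (replay L) (c.item, c.value) := by
  have : Covers (replay (L' ++ [c])) (c.item, c.value) :=
    ⟨c.value, by simp [replay_concat], le_rfl⟩
  exact this.mono (h.replay_dominated hp)

end Markings

/-! ### Writing to the memory -/

namespace Memory

variable {ι M : Type*}

/-- The logs are valid and describe the current result sets. -/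
def LogsValid (s : Memory ι M) : Prop :=
  ∀ d, ValidLog (s.changes d) ∧ replay (s.changes d) = s.marking d

/-- The state `s'` arises from `s` by changes of the result set of `n` alone. -/
structure Grows (n : ι) (s s' : Memory ι M) : Prop where
  marking_of_ne : ∀ k, k ≠ n → s'.marking k = s.marking k
  changes_of_ne : ∀ k, k ≠ n → s'.changes k = s.changes k
  handled : s'.handled = s.handled
  loaded : s'.loaded = s.loaded
  dominated : Dominated (s.marking n) (s'.marking n)
  isPrefix : s.changes n <+: s'.changes n

theorem Grows.refl (n : ι) (s : Memory ι M) : Grows n s s :=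
  ⟨fun _ _ => rfl, fun _ _ => rfl, rfl, rfl, Dominated.refl _, List.prefix_refl _⟩

theorem Grows.trans {n : ι} {s s' s'' : Memory ι M} (h : Grows n s s') (h' : Grows n s' s'') :
    Grows n s s'' where
  marking_of_ne k hk := (h'.marking_of_ne k hk).trans (h.marking_of_ne k hk)
  changes_of_ne k hk := (h'.changes_of_ne k hk).trans (h.changes_of_ne k hk)
  handled := h'.handled.trans h.handled
  loaded := h'.loaded.trans h.loaded
  dominated := h.dominated.trans h'.dominated
  isPrefix := h.isPrefix.trans h'.isPrefix

theorem Grows.tick {n : ι} {s s' : Memory ι M} (h : Grows n s s') (k : ℕ) :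
    Grows n s (s'.tick k) :=
  ⟨h.1, h.2, h.3, h.4, h.5, h.6⟩

theorem Grows.dominated' {n : ι} {s s' : Memory ι M} (h : Grows n s s') (k : ι) :
    Dominated (s.marking k) (s'.marking k) := by
  by_cases hk : k = n
  · subst hk; exact h.dominated
  · rw [h.marking_of_ne k hk]; exact Dominated.refl _

theorem Grows.isPrefix' {n : ι} {s s' : Memory ι M} (h : Grows n s s') (k : ι) :
    s.changes k <+: s'.changes k := by
  by_cases hk : k = n
  · subst hk; exact h.isPrefix
  · rw [h.changes_of_ne k hk]

/-- The step counter never influences what is written. This allows effect and cost of the procedure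
to be treated separately. -/
theorem write_tick (s : Memory ι M) (n : ι) (m : M) (φ : ℕ∞) (k : ℕ) :
    (s.tick k).write n m φ = (s.write n m φ).tick k := by
  have e : (s.tick k).marking = s.marking := rfl
  unfold write
  rw [e]
  cases s.marking n m with
  | none => rfl
  | some ψ => dsimp only; split_ifs <;> rfl

theorem tick_tick (s : Memory ι M) (k l : ℕ) : (s.tick k).tick l = s.tick (k + l) := by
  simp [tick, Nat.add_assoc]

theorem record_spec {s : Memory ι M} {n : ι} {c : Change M}
    (hc : c.Fits (s.marking n)) :
    Grows n s (s.record n c.item c.value c) := by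
  refine ⟨fun k hk => by simp [record, hk], fun k hk => by simp [record, hk], rfl, rfl, ?_, ?_⟩
  · simpa [record] using hc.dominated
  · simp [record]

theorem record_logsValid {s : Memory ι M} {n : ι} {c : Change M} (hs : s.LogsValid)
    (hc : c.Fits (s.marking n)) : (s.record n c.item c.value c).LogsValid := by
  intro d
  by_cases hd : d = n
  · subst hd
    obtain ⟨h1, h2⟩ := hs d
    rw [← h2] at hc
    refine ⟨by simpa [record] using h1.concat hc, ?_⟩
    simp [record, replay_concat, h2]
  · simpa [record, hd] using hs d

/-- Writing a marked match leaves the state as it is or records a change that fits. -/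
theorem write_cases (s : Memory ι M) (n : ι) (m : M) (φ : ℕ∞) :
    (s.write n m φ = s ∧ Covers (s.marking n) (m, φ)) ∨
      ∃ c : Change M, c.item = m ∧ c.value = φ ∧ c.Fits (s.marking n) ∧
        s.write n m φ = s.record n c.item c.value c := by
  unfold write
  cases h : s.marking n m with
  | none => exact Or.inr ⟨.added m φ, rfl, rfl, h, rfl⟩
  | some ψ =>
    dsimp only
    split_ifs with hlt
    · exact Or.inr ⟨.raised m φ, rfl, rfl, ⟨ψ, h, hlt⟩, rfl⟩
    · exact Or.inl ⟨rfl, ψ, h, not_lt.1 hlt⟩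

theorem write_grows (s : Memory ι M) (n : ι) (m : M) (φ : ℕ∞) : Grows n s (s.write n m φ) := by
  rcases s.write_cases n m φ with ⟨e, _⟩ | ⟨c, _, _, hc, e⟩ <;> rw [e]
  · exact Grows.refl n s
  · exact record_spec hc

theorem LogsValid.write {s : Memory ι M} (hs : s.LogsValid) (n : ι) (m : M) (φ : ℕ∞) :
    (s.write n m φ).LogsValid := by
  rcases s.write_cases n m φ with ⟨e, _⟩ | ⟨c, _, _, hc, e⟩ <;> rw [e]
  · exact hs
  · exact record_logsValid hs hc

theorem write_covers (s : Memory ι M) (n : ι) (m : M) (φ : ℕ∞) :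
    Covers ((s.write n m φ).marking n) (m, φ) := by
  rcases s.write_cases n m φ with ⟨e, h⟩ | ⟨c, rfl, rfl, hc, e⟩ <;> rw [e]
  · exact h
  · exact ⟨c.value, by simp [record], le_rfl⟩

/-- A write never invents a value: it leaves a marking alone or sets it to exactly the offered one.
-/
theorem write_marking {s : Memory ι M} {n : ι} {m m' : M} {φ ψ : ℕ∞}
    (h : (s.write n m φ).marking n m' = some ψ) :
    s.marking n m' = some ψ ∨ (m', ψ) = (m, φ) := by
  rcases s.write_cases n m φ with ⟨e, _⟩ | ⟨c, rfl, rfl, hc, e⟩ <;> rw [e] at h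
  · exact Or.inl h
  · by_cases hm : m' = c.item
    · subst hm
      simp [record] at h
      simp [h]
    · left
      simpa [record, hm] using h

/-- Write all marked matches in a list. -/
noncomputable def writeAll (n : ι) (L : List (M × ℕ∞)) (s : Memory ι M) : Memory ι M :=
  L.foldl (fun s a => s.write n a.1 a.2) s

theorem writeAll_tick (n : ι) (L : List (M × ℕ∞)) (s : Memory ι M) (k : ℕ) :
    writeAll n L (s.tick k) = (writeAll n L s).tick k := by
  induction L generalizing s with
  | nil => rfl
  | cons a L ih =>
    change writeAll n L ((s.tick k).write n a.1 a.2) = (writeAll n L (s.write n a.1 a.2)).tick k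
    rw [write_tick, ih]

theorem writeAll_steps (n : ι) (L : List (M × ℕ∞)) (s : Memory ι M) :
    (writeAll n L s).steps = s.steps := by
  induction L generalizing s with
  | nil => rfl
  | cons a L ih =>
    change (writeAll n L (s.write n a.1 a.2)).steps = _
    rw [ih]
    rcases s.write_cases n a.1 a.2 with ⟨e, _⟩ | ⟨c, _, _, _, e⟩ <;> rw [e]
    rfl

theorem writeAll_grows (n : ι) (L : List (M × ℕ∞)) (s : Memory ι M) :
    Grows n s (writeAll n L s) := by
  induction L generalizing s with
  | nil => exact Grows.refl n s
  | cons a L ih => exact (s.write_grows n a.1 a.2).trans (ih _)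

theorem LogsValid.writeAll {s : Memory ι M} (hs : s.LogsValid) (n : ι) (L : List (M × ℕ∞)) :
    (writeAll n L s).LogsValid := by
  induction L generalizing s with
  | nil => exact hs
  | cons a L ih => exact ih (hs.write n a.1 a.2)

/-- Only a lower bound can be claimed, since another entry of the list, or the old state, may give
the same match a higher marking. -/
theorem writeAll_covers (n : ι) (L : List (M × ℕ∞)) (s : Memory ι M) :
    ∀ a ∈ L, Covers ((writeAll n L s).marking n) a := by
  induction L generalizing s with
  | nil => simp
  | cons b L ih =>
    intro a ha
    rcases List.mem_cons.1 ha with rfl | ha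
    · exact (s.write_covers n a.1 a.2).mono (writeAll_grows n L _).dominated
    · exact ih _ a ha

theorem writeAll_marking {n : ι} {L : List (M × ℕ∞)} {s : Memory ι M} {m : M} {ψ : ℕ∞}
    (h : (writeAll n L s).marking n m = some ψ) : s.marking n m = some ψ ∨ (m, ψ) ∈ L := by
  induction L generalizing s with
  | nil => exact Or.inl h
  | cons b L ih =>
    rcases ih (s := s.write n b.1 b.2) h with h | h
    · rcases write_marking h with h | h
      · exact Or.inl h
      · exact Or.inr (by simp [h])
    · exact Or.inr (List.mem_cons_of_mem _ h)

/-- The analogue of `writeAll_marking` for the whole log: it controls every value ever recorded,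
including those overwritten since, which matters for counting raises. -/
theorem mem_writeAll_changes {n : ι} {L : List (M × ℕ∞)} {s : Memory ι M} {c : Change M}
    (h : c ∈ (writeAll n L s).changes n) : c ∈ s.changes n ∨ (c.item, c.value) ∈ L := by
  induction L generalizing s with
  | nil => exact Or.inl h
  | cons b L ih =>
    rcases ih (s := s.write n b.1 b.2) h with h | h
    · rcases s.write_cases n b.1 b.2 with ⟨e, _⟩ | ⟨c', h1, h2, _, e⟩ <;> rw [e] at h
      · exact Or.inl h
      · simp only [record, Function.update_self, List.mem_append, List.mem_singleton] at h
        rcases h with h | rfl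
        · exact Or.inl h
        · exact Or.inr (by simp [h1, h2])
    · exact Or.inr (List.mem_cons_of_mem _ h)

end Memory

/-! ### Partial maps with a given domain -/

namespace PMap

variable {VQ EQ VH EH : Type*} {G : DirGraph VQ EQ}

/-- The domain of `m` is the subgraph `S`. -/
def HasDomain (m : PMap VQ EQ VH EH) (S : Subgraph G) : Prop :=
  (∀ v, (m.1 v).isSome ↔ v ∈ S.verts) ∧ ∀ e, (m.2 e).isSome ↔ e ∈ S.edges

/-- The two maps agree on the subgraph `S`. -/
theorem restrict_eq_restrict_iff {m m' : PMap VQ EQ VH EH} {S : Subgraph G} :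
    m.restrict S = m'.restrict S ↔
      (∀ v ∈ S.verts, m.1 v = m'.1 v) ∧ ∀ e ∈ S.edges, m.2 e = m'.2 e := by
  constructor
  · intro h
    refine ⟨fun v hv => ?_, fun e he => ?_⟩
    · simpa [restrict, hv] using congrFun (congrArg Prod.fst h) v
    · simpa [restrict, he] using congrFun (congrArg Prod.snd h) e
  · rintro ⟨h1, h2⟩
    refine Prod.ext (funext fun v => ?_) (funext fun e => ?_)
    · by_cases hv : v ∈ S.verts <;> simp [restrict, hv, h1]
    · by_cases he : e ∈ S.edges <;> simp [restrict, he, h2]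

/-- The union prefers its first argument, but where both maps are defined they agree, so the
preference is invisible. -/
theorem union_comm {m m' : PMap VQ EQ VH EH} {A B : Subgraph G} (hm : m.HasDomain A)
    (hm' : m'.HasDomain B) (h : m.restrict (A ⊓ B) = m'.restrict (A ⊓ B)) :
    m.union m' = m'.union m := by
  obtain ⟨h1, h2⟩ := restrict_eq_restrict_iff.1 h
  refine Prod.ext (funext fun v => ?_) (funext fun e => ?_)
  · have a := hm.1 v
    have b := hm'.1 v
    have c := h1 v
    change v ∈ A.verts ∩ B.verts → _ at c
    cases x : m.1 v <;> cases y : m'.1 v <;> simp_all [union]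
  · have a := hm.2 e
    have b := hm'.2 e
    have c := h2 e
    change e ∈ A.edges ∩ B.edges → _ at c
    cases x : m.2 e <;> cases y : m'.2 e <;> simp_all [union]

/-- The first argument takes precedence, so it is recovered without any compatibility assumption.
With the right-hand version, a join result determines both matches it was built from. -/
theorem restrict_union_left {m m' : PMap VQ EQ VH EH} {A : Subgraph G} (hm : m.HasDomain A) :
    (m.union m').restrict A = m := by
  refine Prod.ext (funext fun v => ?_) (funext fun e => ?_)
  · have a := hm.1 v
    by_cases hv : v ∈ A.verts <;> cases x : m.1 v <;> simp_all [union, restrict]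
  · have a := hm.2 e
    by_cases hv : e ∈ A.edges <;> cases x : m.2 e <;> simp_all [union, restrict]

theorem restrict_union_right {m m' : PMap VQ EQ VH EH} {A B : Subgraph G} (hm : m.HasDomain A)
    (hm' : m'.HasDomain B) (h : m.restrict (A ⊓ B) = m'.restrict (A ⊓ B)) :
    (m.union m').restrict B = m' := by
  rw [union_comm hm hm' h, restrict_union_left hm']

theorem size_restrict_le [Finite VQ] [Finite EQ] (m : PMap VQ EQ VH EH) (S : Subgraph G) :
    (m.restrict S).size ≤ m.size := by
  refine Nat.add_le_add (Set.ncard_le_ncard (fun v hv => ?_) (Set.toFinite _))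
    (Set.ncard_le_ncard (fun e he => ?_) (Set.toFinite _))
  · by_cases h : v ∈ S.verts <;> simp_all [restrict]
  · by_cases h : e ∈ S.edges <;> simp_all [restrict]

theorem HasDomain.size_eq {m : PMap VQ EQ VH EH} {S : Subgraph G} (h : m.HasDomain S) :
    m.size = S.verts.ncard + S.edges.ncard := by
  unfold size
  congr 2
  · ext v; exact h.1 v
  · ext e; exact h.2 e

end PMap

theorem mem_enumerate {α : Type*} [Finite α] {s : Set α} {a : α} : a ∈ enumerate s ↔ a ∈ s := by
  simp [enumerate]

theorem nodup_enumerate {α : Type*} [Finite α] (s : Set α) : (enumerate s).Nodup :=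
  Finset.nodup_toList _

/-! ### Generators of the results of a node -/

namespace MarkingNet

section Generators

variable {TV TE VQ EQ VH EH ι : Type*} {TG : DirGraph TV TE} {Q : TypedGraph TG VQ EQ}

/-- The list of dependencies of a node, in the order in which they are handled. -/
noncomputable def depList (N : MarkingNet Q.toDirGraph ι) (n : ι) : List ι :=
  match N.kind n with
  | .vertexInput => []
  | .union D => D.toList
  | .navigation d => [d]
  | .projection d => [d]
  | .assignment _ d => [d]
  | .filter _ d => [d]
  | .join l r => [l, r]

/-- The marked matches obtained from markings `C` of the dependencies of `n`, without the selection
of the maximal marking of each match. -/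
def candidates (N : MarkingNet Q.toDirGraph ι) (H : TypedGraph TG VH EH)
    (Hp : Subgraph H.toDirGraph) (C : ι → PMap VQ EQ VH EH → Option ℕ∞) (n : ι) :
    Set (PMap VQ EQ VH EH × ℕ∞) :=
  match N.kind n with
  | .vertexInput => {a | a.1 ∈ allMatches Q H (N.query n) Hp ∧ a.2 = ⊤}
  | .union D => {a | ∃ d ∈ D, C d a.1 = some a.2}
  | .navigation d =>
      {a | a.1 ∈ allMatches Q H (N.query n) ⊤ ∧ C d (a.1.restrict (N.query d)) = some a.2}
  | .projection d => {a | ∃ m, a.1 = m.restrict (N.query n) ∧ C d m = some a.2}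
  | .assignment x d => {a | (∃ φ, C d a.1 = some φ) ∧ a.2 = x}
  | .filter x d => {a | C d a.1 = some a.2 ∧ x < a.2}
  | .join l r =>
      {a | ∃ ml φl mr φr, C l ml = some φl ∧ C r mr = some φr ∧
        ml.restrict (N.query l ⊓ N.query r) = mr.restrict (N.query l ⊓ N.query r) ∧
        a = (ml.union mr, max φl φr)}

variable {N : MarkingNet Q.toDirGraph ι} {H : TypedGraph TG VH EH} {Hp : Subgraph H.toDirGraph}

theorem candidates_congr {C C' : ι → PMap VQ EQ VH EH → Option ℕ∞} {n : ι}
    (h : ∀ d ∈ N.depList n, C d = C' d) : N.candidates H Hp C n = N.candidates H Hp C' n := by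
  unfold candidates
  unfold depList at h
  cases hk : N.kind n with
  | vertexInput => rfl
  | union D =>
    simp only [hk, Finset.mem_toList] at h
    ext a
    simp only [Set.mem_ofPred_eq]
    exact exists_congr fun d => and_congr_right fun hd => by rw [h d hd]
  | _ => simp [hk] at h; simp [h]

/-- No node kind reacts negatively to a higher marking: a filter lets more pass, an assignment
ignores the value, and a join takes a maximum. Hence candidates survive changes of the dependencies,
possibly with a higher marking. -/
theorem candidates_mono {C C' : ι → PMap VQ EQ VH EH → Option ℕ∞}
    (h : ∀ d, Dominated (C d) (C' d)) {n : ι} {a : PMap VQ EQ VH EH × ℕ∞}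
    (ha : a ∈ N.candidates H Hp C n) : ∃ φ, a.2 ≤ φ ∧ (a.1, φ) ∈ N.candidates H Hp C' n := by
  unfold candidates at ha ⊢
  obtain ⟨m, ψ⟩ := a
  cases hk : N.kind n with
  | vertexInput => rw [hk] at ha; exact ⟨ψ, le_rfl, ha⟩
  | union D =>
    rw [hk] at ha
    obtain ⟨d, hd, e⟩ := ha
    obtain ⟨φ, h1, h2⟩ := h d _ _ e
    exact ⟨φ, h2, d, hd, h1⟩
  | navigation d =>
    rw [hk] at ha
    obtain ⟨hm, e⟩ := ha
    obtain ⟨φ, h1, h2⟩ := h d _ _ e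
    exact ⟨φ, h2, hm, h1⟩
  | projection d =>
    rw [hk] at ha
    obtain ⟨m', hm, e⟩ := ha
    obtain ⟨φ, h1, h2⟩ := h d _ _ e
    exact ⟨φ, h2, m', hm, h1⟩
  | assignment x d =>
    rw [hk] at ha
    obtain ⟨⟨φ', e⟩, rfl⟩ := ha
    obtain ⟨φ, h1, h2⟩ := h d _ _ e
    exact ⟨ψ, le_rfl, ⟨φ, h1⟩, rfl⟩
  | filter x d =>
    rw [hk] at ha
    obtain ⟨e, hx⟩ := ha
    obtain ⟨φ, h1, h2⟩ := h d _ _ e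
    exact ⟨φ, h2, h1, lt_of_lt_of_le hx h2⟩
  | join l r =>
    rw [hk] at ha
    obtain ⟨ml, φl, mr, φr, hl, hr, hc, e⟩ := ha
    obtain ⟨ψl, h1, h2⟩ := h l _ _ hl
    obtain ⟨ψr, h3, h4⟩ := h r _ _ hr
    cases e
    exact ⟨max ψl ψr, max_le_max h2 h4, ml, ψl, mr, ψr, h1, h3, hc, rfl⟩

/-- The sets `B n` of matches contain all results of the nodes, and `X` their markings, whatever
the order of execution. The matches of the dependencies of a join have the right domains, and no
node depends on itself. -/
def Bounds (N : MarkingNet Q.toDirGraph ι) (H : TypedGraph TG VH EH) (Hp : Subgraph H.toDirGraph)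
    (B : ι → Set (PMap VQ EQ VH EH)) (X : Set ℕ∞) : Prop :=
  ∀ n, n ∉ N.depList n ∧
    match N.kind n with
    | .vertexInput => allMatches Q H (N.query n) Hp ⊆ B n ∧ ⊤ ∈ X
    | .union D => ∀ d ∈ D, B d ⊆ B n
    | .navigation _ => allMatches Q H (N.query n) ⊤ ⊆ B n
    | .projection d => ∀ m ∈ B d, m.restrict (N.query n) ∈ B n
    | .assignment x d => B d ⊆ B n ∧ x ∈ X
    | .filter _ d => B d ⊆ B n
    | .join l r => l ≠ r ∧ (∀ m ∈ B l, m.HasDomain (N.query l)) ∧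
        (∀ m ∈ B r, m.HasDomain (N.query r)) ∧
        ∀ ml ∈ B l, ∀ mr ∈ B r,
          ml.restrict (N.query l ⊓ N.query r) = mr.restrict (N.query l ⊓ N.query r) →
          ml.union mr ∈ B n

/-- Every match that is marked in `C` belongs to the bounding set `B`. -/
def InBounds (B : ι → Set (PMap VQ EQ VH EH)) (C : ι → PMap VQ EQ VH EH → Option ℕ∞) : Prop :=
  ∀ n m φ, C n m = some φ → m ∈ B n

variable {B : ι → Set (PMap VQ EQ VH EH)} {X : Set ℕ∞}

/-- The target results are the candidates with maximal markings. -/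
theorem results_eq_candidates (hB : N.Bounds H Hp B X) {C : ι → PMap VQ EQ VH EH → Option ℕ∞}
    (hC : InBounds B C) (n : ι) :
    N.results H Hp (fun k => {a | C k a.1 = some a.2}) n =
      {a | IsGreatest {φ | (a.1, φ) ∈ N.candidates H Hp C n} a.2} := by
  have hn := (hB n).2
  ext ⟨m, φ⟩
  unfold results candidates
  cases hk : N.kind n with
  | vertexInput =>
    simp only [Set.mem_ofPred_eq]
    constructor
    · rintro ⟨h, rfl⟩
      exact ⟨⟨h, rfl⟩, fun ψ _ => le_top⟩
    · rintro ⟨h, -⟩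
      exact h
  | union D => simp
  | navigation d =>
    simp only [Set.mem_ofPred_eq]
    constructor
    · rintro ⟨h, h1, h2⟩
      exact ⟨⟨h, h1⟩, fun ψ hψ => h2 hψ.2⟩
    · rintro ⟨⟨h, h1⟩, h2⟩
      exact ⟨h, h1, fun ψ hψ => h2 ⟨h, hψ⟩⟩
  | projection d =>
    simp only [Set.mem_ofPred_eq]
    constructor
    · rintro ⟨m', rfl, h1, h2⟩
      exact ⟨⟨m', rfl, h1⟩, fun ψ ⟨m'', e, hψ⟩ => h2.2 ⟨m'', hψ, e.symm⟩⟩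
    · rintro ⟨⟨m', rfl, h1⟩, h2⟩
      exact ⟨m', rfl, h1, ⟨m', h1, rfl⟩, fun ψ ⟨m'', hψ, e⟩ => h2 ⟨m'', e.symm, hψ⟩⟩
  | assignment x d =>
    simp only [Set.mem_ofPred_eq]
    constructor
    · rintro ⟨h, rfl⟩
      exact ⟨⟨h, rfl⟩, fun ψ hψ => hψ.2.le⟩
    · rintro ⟨h, -⟩
      exact h
  | filter x d =>
    simp only [Set.mem_ofPred_eq]
    constructor
    · rintro ⟨h, hx⟩
      refine ⟨⟨h, hx⟩, fun ψ hψ => ?_⟩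
      have := hψ.1
      simp only [h, Option.some.injEq] at this
      exact this.ge
    · rintro ⟨h, -⟩
      exact h
  | join l r =>
    simp only [hk] at hn
    obtain ⟨-, hl, hr, -⟩ := hn
    simp only [Set.mem_ofPred_eq]
    constructor
    · rintro ⟨⟨ml, φl⟩, h1, ⟨mr, φr⟩, h2, hc, e⟩
      simp only [Prod.mk.injEq] at e
      obtain ⟨rfl, rfl⟩ := e
      dsimp only [Set.mem_ofPred_eq] at h1 h2 hc
      refine ⟨⟨ml, φl, mr, φr, h1, h2, hc, rfl⟩, ?_⟩
      rintro ψ ⟨ml', φl', mr', φr', h3, h4, hc', e⟩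
      simp only [Prod.mk.injEq] at e
      obtain ⟨e, rfl⟩ := e
      -- The target set of a join selects no maximum. None is needed: the union determines its two
      -- parts by restriction, and each part has one marking, so each join result has a single
      -- candidate marking.
      have a1 := hl _ (hC _ _ _ h1)
      have a2 := hr _ (hC _ _ _ h2)
      have a3 := hl _ (hC _ _ _ h3)
      have a4 := hr _ (hC _ _ _ h4)
      have e1 : ml = ml' := by
        rw [← PMap.restrict_union_left (m' := mr) a1, e, PMap.restrict_union_left a3]
      have e2 : mr = mr' := by
        rw [← PMap.restrict_union_right a1 a2 hc, e, PMap.restrict_union_right a3 a4 hc']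
      subst e1 e2
      rw [h1] at h3
      rw [h2] at h4
      cases h3
      cases h4
      exact le_rfl
    · rintro ⟨⟨ml, φl, mr, φr, h1, h2, hc, e⟩, -⟩
      exact ⟨(ml, φl), h1, (mr, φr), h2, hc, e⟩

end Generators

end MarkingNet

namespace MarkingNet

variable {TV TE VQ EQ VH EH ι : Type*} {TG : DirGraph TV TE}
  {Q : TypedGraph TG VQ EQ} {N : MarkingNet Q.toDirGraph ι} {H : TypedGraph TG VH EH}
  {Hp : Subgraph H.toDirGraph} {B : ι → Set (PMap VQ EQ VH EH)} {X : Set ℕ∞}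

/-! ### Joins seen from one of their dependencies -/

-- A change may arrive from either side of a join. Placing the changed side `d` first, and naming
-- the opposite side by the `if`, lets one argument serve both; commutativity of compatible unions
-- justifies the swap.
open Classical in
theorem Bounds.join {n l r d : ι} (hB : N.Bounds H Hp B X) (hk : N.kind n = .join l r)
    (hd : d = l ∨ d = r) {m m' : PMap VQ EQ VH EH} (hm : m ∈ B d)
    (hm' : m' ∈ B (if d = l then r else l))
    (hc : m.restrict (N.query l ⊓ N.query r) = m'.restrict (N.query l ⊓ N.query r)) :
    m.union m' ∈ B n ∧ m.union m' = m'.union m ∧ (m.union m').restrict (N.query d) = m ∧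
      (m.union m').restrict (N.query (if d = l then r else l)) = m' := by
  have hn := (hB n).2
  rw [hk] at hn
  obtain ⟨hne, hl, hr, hu⟩ := hn
  rcases hd with rfl | rfl
  · simp only [if_true] at hm' ⊢
    exact ⟨hu m hm m' hm' hc, PMap.union_comm (hl m hm) (hr m' hm') hc,
      PMap.restrict_union_left (hl m hm), PMap.restrict_union_right (hl m hm) (hr m' hm') hc⟩
  · simp only [if_neg hne.symm] at hm' ⊢
    have e := PMap.union_comm (hl m' hm') (hr m hm) hc.symm
    refine ⟨e ▸ hu m' hm' m hm hc.symm, e.symm, PMap.restrict_union_left (hr m hm), ?_⟩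
    rw [← e]
    exact PMap.restrict_union_left (hl m' hm')

open Classical in
theorem mem_candidates_join {n l r d : ι} (hB : N.Bounds H Hp B X) (hk : N.kind n = .join l r)
    (hd : d = l ∨ d = r) {C : ι → PMap VQ EQ VH EH → Option ℕ∞} (hC : InBounds B C)
    {a : PMap VQ EQ VH EH × ℕ∞} :
    a ∈ N.candidates H Hp C n ↔ ∃ m φ m' φ', C d m = some φ ∧
      C (if d = l then r else l) m' = some φ' ∧
      m.restrict (N.query l ⊓ N.query r) = m'.restrict (N.query l ⊓ N.query r) ∧
      a = (m.union m', max φ φ') := by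
  have hne : l ≠ r := by
    have hn := (hB n).2
    rw [hk] at hn
    exact hn.1
  unfold candidates
  simp only [hk, Set.mem_ofPred_eq]
  rcases hd with rfl | rfl
  · simp
  · simp only [if_neg hne.symm]
    constructor
    · rintro ⟨ml, φl, mr, φr, h1, h2, hc, rfl⟩
      have := hB.join hk (Or.inl rfl) (hC _ _ _ h1) (by simpa using hC _ _ _ h2) hc
      exact ⟨mr, φr, ml, φl, h2, h1, hc.symm, by rw [this.2.1, max_comm]⟩
    · rintro ⟨mr, φr, ml, φl, h2, h1, hc, rfl⟩
      have := hB.join hk (Or.inl rfl) (hC _ _ _ h1) (by simpa using hC _ _ _ h2) hc.symm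
      exact ⟨ml, φl, mr, φr, h1, h2, hc.symm, by rw [this.2.1, max_comm]⟩

/-! ### The marked matches written when a change is handled -/

/-- Splits the operation into a cost-free effect and a delay, so that correctness concerns only
`writeAll`. -/
theorem offerAll_eq (n : ι) (L : List (PMap VQ EQ VH EH × ℕ∞))
    (s : Memory ι (PMap VQ EQ VH EH)) :
    offerAll n L s = (s.writeAll n L).tick (L.map fun a => a.1.size + 1).sum := by
  induction L generalizing s with
  | nil => rfl
  | cons a L ih =>
    change offerAll n L ((s.tick (a.1.size + 1)).write n a.1 a.2) =
      (Memory.writeAll n L (s.write n a.1 a.2)).tick _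
    rw [ih, Memory.write_tick, Memory.writeAll_tick, Memory.tick_tick]
    simp

theorem raiseAll_eq (n : ι) (L : List (PMap VQ EQ VH EH)) (φ : ℕ∞)
    (s : Memory ι (PMap VQ EQ VH EH)) :
    raiseAll n L φ s = (s.writeAll n (L.map fun m => (m, φ))).tick L.length := by
  induction L generalizing s with
  | nil => rfl
  | cons a L ih =>
    change raiseAll n L φ ((s.tick 1).write n a φ) =
      (Memory.writeAll n (L.map fun m => (m, φ)) (s.write n a φ)).tick _
    rw [ih, Memory.write_tick, Memory.writeAll_tick, Memory.tick_tick, Nat.add_comm 1]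
    rfl

/-- The results of `n` that may be written when a change of the match `m` of `d` is handled. -/
def scope (N : MarkingNet Q.toDirGraph ι) (B : ι → Set (PMap VQ EQ VH EH)) (n d : ι)
    (m : PMap VQ EQ VH EH) : Set (PMap VQ EQ VH EH) :=
  match N.kind n with
  | .vertexInput => ∅
  | .union _ => {m}
  | .navigation _ => {m' | m' ∈ B n ∧ m'.restrict (N.query d) = m}
  | .projection _ => {m.restrict (N.query n)}
  | .assignment _ _ => {m}
  | .filter _ _ => {m}
  | .join _ _ => {m' | m' ∈ B n ∧ m'.restrict (N.query d) = m}

theorem scope_subset (hB : N.Bounds H Hp B X) {n d : ι} (hd : d ∈ N.depList n)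
    {m : PMap VQ EQ VH EH} (hm : m ∈ B d) : N.scope B n d m ⊆ B n := by
  have hn := (hB n).2
  intro m' hm'
  unfold depList at hd
  unfold scope at hm'
  cases hk : N.kind n <;> simp only [hk] at hn hd hm'
  case vertexInput => simp at hd
  case union D => rw [hm']; exact hn d (by simpa using hd) hm
  case navigation => exact hm'.1
  case projection => simp at hd; subst hd; rw [hm']; exact hn m hm
  case assignment => simp at hd; subst hd; rw [hm']; exact hn.1 hm
  case filter => simp at hd; subst hd; rw [hm']; exact hn hm
  case join => exact hm'.1

theorem stored_iff {s : Memory ι (PMap VQ EQ VH EH)} {n : ι} {m : PMap VQ EQ VH EH} :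
    m ∈ s.stored n ↔ ∃ φ, s.marking n m = some φ := Option.isSome_iff_exists

variable [Finite VQ] [Finite EQ] [Finite VH] [Finite EH]

/-- The marked matches that node `n` writes when it handles the change `c` of `d`. -/
noncomputable def offers (N : MarkingNet Q.toDirGraph ι) (H : TypedGraph TG VH EH)
    (s : Memory ι (PMap VQ EQ VH EH)) (n d : ι) :
    Change (PMap VQ EQ VH EH) → List (PMap VQ EQ VH EH × ℕ∞)
  | .added m φ => N.newResults H s n d m φ
  | .raised m φ => (N.associatedResults s n d m φ).map fun m' => (m', φ)

/-- The number of steps that `n` needs to handle the change `c` of `d`. -/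
noncomputable def toll (N : MarkingNet Q.toDirGraph ι) (H : TypedGraph TG VH EH)
    (s : Memory ι (PMap VQ EQ VH EH)) (n d : ι) : Change (PMap VQ EQ VH EH) → ℕ
  | .added m φ => m.size + ((N.newResults H s n d m φ).map fun a => a.1.size + 1).sum
  | .raised m φ => 1 + (N.associatedResults s n d m φ).length

theorem handleChange_eq (n d : ι) (s : Memory ι (PMap VQ EQ VH EH))
    (c : Change (PMap VQ EQ VH EH)) :
    N.handleChange H n d s c = (s.writeAll n (N.offers H s n d c)).tick (N.toll H s n d c) := by
  cases c with
  | added m φ =>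
    simp only [handleChange, offers, toll, offerAll_eq, Memory.writeAll_tick, Memory.tick_tick]
  | raised m φ =>
    simp only [handleChange, offers, toll, raiseAll_eq, Memory.writeAll_tick, Memory.tick_tick]

/-- `scope` does not depend on the state. Bounding the offers by it keeps results inside `B` and
also yields a state-independent cost bound. For a join, restricting the union to `d` gives back the
changed match. -/
theorem offers_mem_scope (hB : N.Bounds H Hp B X) {s : Memory ι (PMap VQ EQ VH EH)}
    (hs : InBounds B s.marking) {n d : ι} (hd : d ∈ N.depList n)
    {c : Change (PMap VQ EQ VH EH)} (hc : c.item ∈ B d) {a : PMap VQ EQ VH EH × ℕ∞}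
    (ha : a ∈ N.offers H s n d c) : a.1 ∈ N.scope B n d c.item := by
  have hn := (hB n).2
  unfold depList at hd
  unfold scope
  cases c with
  | added m φ =>
    simp only [offers, newResults, Change.item] at ha hc ⊢
    cases hk : N.kind n <;> simp only [hk] at hn hd ha ⊢
    case vertexInput => simp at hd
    case union => simp at ha; simp [ha]
    case navigation =>
      simp only [List.mem_map, mem_enumerate] at ha
      obtain ⟨m', h, rfl⟩ := ha
      exact ⟨hn h.1, h.2⟩
    case projection => simp at ha; simp [ha]
    case assignment => simp at ha; simp [ha]
    case filter x _ => split_ifs at ha <;> simp at ha; simp [ha]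
    case join l r =>
      simp only [List.mem_map, mem_enumerate] at ha
      obtain ⟨m', ⟨h1, h2⟩, rfl⟩ := ha
      obtain ⟨φ', h1⟩ := stored_iff.1 h1
      have := hB.join hk (by simpa using hd) hc (hs _ _ _ h1) h2.symm
      exact ⟨this.1, this.2.2.1⟩
  | raised m φ =>
    simp only [offers, associatedResults, Change.item] at ha hc ⊢
    cases hk : N.kind n <;> simp only [hk] at hn hd ha ⊢
    case vertexInput => simp at hd
    case union => simp at ha; simp [ha]
    case navigation =>
      simp only [List.mem_map, mem_enumerate] at ha
      obtain ⟨m', ⟨h1, h2⟩, rfl⟩ := ha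
      obtain ⟨φ', h1⟩ := stored_iff.1 h1
      exact ⟨hs _ _ _ h1, h2⟩
    case projection => simp at ha; simp [ha]
    case assignment => simp at ha
    case filter x _ => split_ifs at ha <;> simp at ha; simp [ha]
    case join l r =>
      simp only [List.mem_map, mem_enumerate] at ha
      obtain ⟨m', ⟨h1, h2⟩, rfl⟩ := ha
      obtain ⟨φ', h1⟩ := stored_iff.1 h1
      exact ⟨hs _ _ _ h1, h2⟩

theorem offers_value_mem (hB : N.Bounds H Hp B X) {s : Memory ι (PMap VQ EQ VH EH)}
    (hX : ∀ n m φ, s.marking n m = some φ → φ ∈ X) {n d : ι}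
    {c : Change (PMap VQ EQ VH EH)} (hc : c.value ∈ X) {a : PMap VQ EQ VH EH × ℕ∞}
    (ha : a ∈ N.offers H s n d c) : a.2 ∈ X := by
  have hn := (hB n).2
  cases c with
  | added m φ =>
    simp only [offers, newResults, Change.value] at ha hc
    cases hk : N.kind n <;> simp only [hk] at hn ha
    case vertexInput => simp at ha
    case union => simp at ha; simp [ha, hc]
    case navigation =>
      simp only [List.mem_map] at ha
      obtain ⟨m', h, rfl⟩ := ha
      exact hc
    case projection => simp at ha; simp [ha, hc]
    case assignment => simp at ha; simp [ha, hn.2]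
    case filter x _ => split_ifs at ha <;> simp at ha; simp [ha, hc]
    case join l r =>
      simp only [List.mem_map, mem_enumerate] at ha
      obtain ⟨m', ⟨h1, h2⟩, rfl⟩ := ha
      obtain ⟨φ', h1⟩ := stored_iff.1 h1
      rw [h1]
      rcases max_choice φ φ' with e | e
      · simpa [e] using hc
      · simpa [e] using hX _ _ _ h1
  | raised m φ =>
    simp only [offers, List.mem_map] at ha
    obtain ⟨m', h, rfl⟩ := ha
    exact hc

/-- Needed to bound the sum over a list of offers by a sum over a set. In a join, different
complements give different unions because the complement is a restriction of the union. -/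
theorem offers_nodup (hB : N.Bounds H Hp B X) {s : Memory ι (PMap VQ EQ VH EH)}
    (hs : InBounds B s.marking) {n d : ι} (hd : d ∈ N.depList n)
    {c : Change (PMap VQ EQ VH EH)} (hc : c.item ∈ B d) :
    ((N.offers H s n d c).map Prod.fst).Nodup := by
  unfold depList at hd
  cases c with
  | added m φ =>
    simp only [offers, newResults, Change.item] at hc ⊢
    cases hk : N.kind n <;> simp only [hk] at hd ⊢
    case vertexInput => simp
    case union => simp
    case navigation => simpa [Function.comp_def] using nodup_enumerate _
    case projection => simp
    case assignment => simp
    case filter x _ => split_ifs <;> simp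
    case join l r =>
      rw [List.map_map]
      refine (nodup_enumerate _).map_on fun x hx y hy e => ?_
      simp only [mem_enumerate] at hx hy
      obtain ⟨φ, h1⟩ := stored_iff.1 hx.1
      obtain ⟨ψ, h2⟩ := stored_iff.1 hy.1
      have a1 := hB.join hk (by simpa using hd) hc (hs _ _ _ h1) hx.2.symm
      have a2 := hB.join hk (by simpa using hd) hc (hs _ _ _ h2) hy.2.symm
      rw [← a1.2.2.2, ← a2.2.2.2]
      exact congrArg (fun x : PMap VQ EQ VH EH => x.restrict _) e
  | raised m φ =>
    simp only [offers, associatedResults, List.map_map, Function.comp_def, List.map_id']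
    cases hk : N.kind n <;> simp only
    case vertexInput => simp
    case union => simp
    case navigation => exact nodup_enumerate _
    case projection => simp
    case assignment => simp
    case filter x _ => split_ifs <;> simp
    case join l r => exact nodup_enumerate _

/-- The handled change may be stale, with the match raised again since. So the value written is only
bounded by that of a current candidate, obtained by replacing the recorded marking with the current
one. -/
theorem offers_sound (hB : N.Bounds H Hp B X) {s : Memory ι (PMap VQ EQ VH EH)}
    (hs : InBounds B s.marking) {n d : ι} (hd : d ∈ N.depList n)
    (hsound : ∀ m ψ, s.marking n m = some ψ →
      ∃ φ, ψ ≤ φ ∧ (m, φ) ∈ N.candidates H Hp s.marking n)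
    {c : Change (PMap VQ EQ VH EH)} (hc : Covers (s.marking d) (c.item, c.value))
    {a : PMap VQ EQ VH EH × ℕ∞} (ha : a ∈ N.offers H s n d c) :
    ∃ φ, a.2 ≤ φ ∧ (a.1, φ) ∈ N.candidates H Hp s.marking n := by
  obtain ⟨χ, hχ, hle⟩ := hc
  have hcB := hs _ _ _ hχ
  unfold depList at hd
  cases c with
  | added m φ =>
    simp only [offers, newResults, Change.item, Change.value] at ha hχ hle hcB
    cases hk : N.kind n
    case vertexInput => simp [hk] at hd
    case union D =>
      simp only [hk, Finset.mem_toList, List.mem_singleton, candidates] at hd ha ⊢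
      subst ha
      exact ⟨χ, hle, d, hd, hχ⟩
    case navigation d' =>
      simp only [hk, List.mem_singleton, List.mem_map, mem_enumerate, candidates] at hd ha ⊢
      obtain ⟨m', h, rfl⟩ := ha
      subst hd
      refine ⟨χ, hle, h.1, ?_⟩
      simp only [h.2, hχ]
    case projection =>
      simp only [hk, List.mem_singleton, candidates] at hd ha ⊢
      subst hd ha
      exact ⟨χ, hle, m, rfl, hχ⟩
    case assignment x d' =>
      simp only [hk, List.mem_singleton, candidates] at hd ha ⊢
      subst hd ha
      exact ⟨x, le_rfl, ⟨χ, hχ⟩, rfl⟩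
    case filter x d' =>
      simp only [hk, List.mem_singleton, candidates] at hd ha ⊢
      split_ifs at ha with hx
      · simp only [List.mem_singleton] at ha
        subst hd ha
        exact ⟨χ, hle, hχ, lt_of_lt_of_le hx hle⟩
      · simp at ha
    case join l r =>
      simp only [hk, List.mem_map, mem_enumerate] at hd ha
      obtain ⟨m', ⟨h1, h2⟩, rfl⟩ := ha
      obtain ⟨φ', h1⟩ := stored_iff.1 h1
      refine ⟨max χ φ', ?_, (mem_candidates_join hB hk (by simpa using hd) hs).2
        ⟨m, χ, m', φ', hχ, h1, h2.symm, rfl⟩⟩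
      simp only [h1, Option.getD_some]
      exact max_le_max hle le_rfl
  | raised m φ =>
    simp only [offers, associatedResults, Change.item, Change.value] at ha hχ hle hcB
    cases hk : N.kind n
    case vertexInput => simp [hk] at hd
    case union D =>
      simp only [hk, Finset.mem_toList, List.map_singleton, List.mem_singleton, candidates]
        at hd ha ⊢
      subst ha
      exact ⟨χ, hle, d, hd, hχ⟩
    case navigation d' =>
      simp only [hk, List.mem_singleton, List.mem_map, mem_enumerate] at hd ha ⊢
      obtain ⟨m', ⟨h1, h2⟩, rfl⟩ := ha
      obtain ⟨φ', h1⟩ := stored_iff.1 h1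
      -- A raise follows references to stored results without consulting the host graph; that such a
      -- result is a match at all comes from the soundness of its earlier insertion.
      obtain ⟨ψ, -, h3⟩ := hsound _ _ h1
      subst hd
      simp only [candidates, hk] at h3 ⊢
      refine ⟨χ, hle, h3.1, ?_⟩
      simp only [h2, hχ]
    case projection =>
      simp only [hk, List.map_singleton, List.mem_singleton, candidates] at hd ha ⊢
      subst hd ha
      exact ⟨χ, hle, m, rfl, hχ⟩
    case assignment x d' => simp [hk] at ha
    case filter x d' =>
      simp only [hk, List.mem_singleton, candidates] at hd ha ⊢
      split_ifs at ha with hx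
      · simp only [List.map_singleton, List.mem_singleton] at ha
        subst hd ha
        exact ⟨χ, hle, hχ, lt_of_lt_of_le hx hle⟩
      · simp at ha
    case join l r =>
      simp only [hk, List.mem_map, mem_enumerate] at hd ha
      obtain ⟨m', ⟨h1, h2⟩, rfl⟩ := ha
      obtain ⟨φ', h1⟩ := stored_iff.1 h1
      have hd' : d = l ∨ d = r := by simpa using hd
      obtain ⟨ψ, -, h3⟩ := hsound _ _ h1
      -- A raise at a join writes `φ` alone, not the maximum with the other side. The candidate's
      -- marking is the maximum of the current markings of both sides, hence at least `φ`.
      refine ⟨ψ, ?_, h3⟩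
      obtain ⟨m₁, φ₁, m₂, φ₂, e1, e2, hcomp, e⟩ := (mem_candidates_join hB hk hd' hs).1 h3
      simp only [Prod.mk.injEq] at e
      obtain ⟨rfl, rfl⟩ := e
      have := hB.join hk hd' (hs _ _ _ e1) (hs _ _ _ e2) hcomp
      rw [this.2.2.1] at h2
      subst h2
      rw [hχ] at e1
      cases e1
      exact hle.trans (le_max_left _ _)

open Classical in
/-- When a change of `d` has been handled, `n` covers all candidates of the extended view. -/
theorem offers_complete (hB : N.Bounds H Hp B X) {s : Memory ι (PMap VQ EQ VH EH)}
    (hs : InBounds B s.marking) {n d : ι} (hd : d ∈ N.depList n)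
    {V : ι → PMap VQ EQ VH EH → Option ℕ∞} (hV : ∀ k, Dominated (V k) (s.marking k))
    {c : Change (PMap VQ EQ VH EH)} (hc : Covers (s.marking d) (c.item, c.value))
    (hfit : c.Fits (V d)) {f : PMap VQ EQ VH EH → Option ℕ∞}
    (hf : ∀ a ∈ N.candidates H Hp V n, Covers (s.marking n) a)
    (hsf : Dominated (s.marking n) f) (hof : ∀ a ∈ N.offers H s n d c, Covers f a)
    {a : PMap VQ EQ VH EH × ℕ∞}
    (ha : a ∈ N.candidates H Hp
      (Function.update V d (Function.update (V d) c.item (some c.value))) n) : Covers f a := by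
  have hVB : InBounds B V := fun k m φ h => by
    obtain ⟨ψ, h1, -⟩ := hV k m φ h
    exact hs _ _ _ h1
  have hcB : c.item ∈ B d := by
    obtain ⟨χ, hχ, -⟩ := hc
    exact hs _ _ _ hχ
  set V' := Function.update V d (Function.update (V d) c.item (some c.value)) with hV'
  have hV'B : InBounds B V' := fun k m φ h => by
    by_cases hk : k = d
    · subst hk
      by_cases hm : m = c.item
      · rw [hm]; exact hcB
      · exact hVB k m φ (by simpa [hV', hm] using h)
    · exact hVB k m φ (by simpa [hV', hk] using h)
  have hf' : ∀ a ∈ N.candidates H Hp V n, Covers f a := fun a ha => (hf a ha).mono hsf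
  -- The extended view differs from the old one in one entry, so a new candidate must use exactly
  -- that entry; all others are covered already.
  have key : ∀ k m φ, V' k m = some φ → V k m = some φ ∨ (k = d ∧ m = c.item ∧ φ = c.value) := by
    intro k m φ h
    by_cases hk : k = d
    · subst hk
      by_cases hm : m = c.item
      · subst hm
        simp [hV'] at h
        simp [h]
      · left
        simpa [hV', hm] using h
    · left
      simpa [hV', hk] using h
  -- A raise presupposes that the match was in the view, so the results built from it are already
  -- stored and can be reached by reference.
  have hold : ∀ m φ, c = .raised m φ → ∃ ψ, V d m = some ψ := by
    rintro m φ rfl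
    obtain ⟨ψ, h, -⟩ := hfit
    exact ⟨ψ, h⟩
  obtain ⟨m₀, φ₀⟩ := a
  unfold depList at hd
  cases hk : N.kind n
  case vertexInput => simp [hk] at hd
  case union D =>
    simp only [candidates, hk] at ha hf'
    obtain ⟨k, hkD, h⟩ := ha
    rcases key _ _ _ h with h | ⟨rfl, e1, e2⟩
    · exact hf' _ ⟨k, hkD, h⟩
    · simp only at e1 e2
      subst e1 e2
      apply hof
      cases c <;> simp [offers, newResults, associatedResults, hk, Change.item, Change.value]
  case navigation d' =>
    simp only [hk, List.mem_singleton] at hd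
    subst hd
    simp only [candidates, hk] at ha hf'
    obtain ⟨h0, h⟩ := ha
    simp only at h h0
    rcases key _ _ _ h with h | ⟨-, e1, e2⟩
    · exact hf' _ ⟨h0, h⟩
    · subst e2
      apply hof
      cases c with
      | added m φ =>
        simp only [offers, newResults, hk, List.mem_map, mem_enumerate]
        exact ⟨m₀, ⟨h0, e1⟩, rfl⟩
      | raised m φ =>
        simp only [offers, associatedResults, hk, List.mem_map, mem_enumerate]
        obtain ⟨ψ, hψ⟩ := hold m φ rfl
        have : (m₀, ψ) ∈ N.candidates H Hp V n := by
          simp only [candidates, hk]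
          refine ⟨h0, ?_⟩
          simp only [e1]
          exact hψ
        obtain ⟨χ, h1, -⟩ := hf _ this
        exact ⟨m₀, ⟨stored_iff.2 ⟨χ, h1⟩, e1⟩, rfl⟩
  case projection d' =>
    simp only [hk, List.mem_singleton] at hd
    subst hd
    simp only [candidates, hk] at ha hf'
    obtain ⟨m, rfl, h⟩ := ha
    rcases key _ _ _ h with h | ⟨-, rfl, e2⟩
    · exact hf' _ ⟨m, rfl, h⟩
    · simp only at e2
      subst e2
      apply hof
      cases c <;> simp [offers, newResults, associatedResults, hk, Change.item, Change.value]
  case assignment x d' =>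
    simp only [hk, List.mem_singleton] at hd
    subst hd
    simp only [candidates, hk] at ha hf'
    obtain ⟨⟨φ, h⟩, e⟩ := ha
    simp only at e
    subst e
    rcases key _ _ _ h with h | ⟨-, e1, e2⟩
    · exact hf' _ ⟨⟨φ, h⟩, rfl⟩
    · simp only at e1
      subst e1 e2
      cases c with
      | added m φ => apply hof; simp [offers, newResults, hk, Change.item]
      -- An assignment discards the incoming marking, so a raise creates no new candidate and
      -- nothing has to be written.
      | raised m φ => exact hf' _ ⟨hold m φ rfl, rfl⟩
  case filter x d' =>
    simp only [hk, List.mem_singleton] at hd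
    subst hd
    simp only [candidates, hk] at ha hf'
    obtain ⟨h, hx⟩ := ha
    simp only at hx
    rcases key _ _ _ h with h | ⟨-, e1, e2⟩
    · exact hf' _ ⟨h, hx⟩
    · simp only at e1 e2
      subst e1 e2
      apply hof
      cases c <;> simp only [Change.value] at hx <;>
        simp [offers, newResults, associatedResults, hk, Change.item, Change.value, hx]
  case join l r =>
    have hd' : d = l ∨ d = r := by simpa [hk] using hd
    have hne : (if d = l then r else l) ≠ d := by
      have hn := (hB n).2
      rw [hk] at hn
      rcases hd' with rfl | rfl
      · simpa using hn.1.symm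
      · simpa [if_neg hn.1.symm] using hn.1
    obtain ⟨m, φ, m', φ', h, hm', hcomp, e⟩ := (mem_candidates_join hB hk hd' hV'B).1 ha
    cases e
    have h' : V (if d = l then r else l) m' = some φ' := by simpa [hV', hne] using hm'
    rcases key _ _ _ h with h | ⟨-, rfl, rfl⟩
    · exact hf' _ ((mem_candidates_join hB hk hd' hVB).2 ⟨m, φ, m', φ', h, h', hcomp, rfl⟩)
    · cases c with
      | added m φ =>
        -- The complement is read from the current memory, not from the view; its current marking is
        -- at least the one in the view.
        obtain ⟨ψ, h1, h2⟩ := hV _ _ _ h'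
        refine Covers.of_le (ψ := max φ ψ) (hof _ ?_) (max_le_max le_rfl h2)
        simp only [offers, newResults, hk, List.mem_map, mem_enumerate]
        refine ⟨m', ⟨stored_iff.2 ⟨ψ, h1⟩, hcomp.symm⟩, ?_⟩
        simp only [h1, Option.getD_some, Change.item]
      | raised m φ =>
        obtain ⟨ψ, hψ⟩ := hold m φ rfl
        have hst := hf _ ((mem_candidates_join hB hk hd' hVB).2
          ⟨m, ψ, m', φ', hψ, h', hcomp, rfl⟩)
        -- The stored result already covers the other side's `φ'`, and the raise supplies `φ`;
        -- together they cover the maximum.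
        refine Covers.max ?_ ((hst.mono hsf).of_le (le_max_right _ _))
        apply hof
        simp only [offers, associatedResults, hk, List.mem_map, mem_enumerate]
        obtain ⟨χ, h1, -⟩ := hst
        have := hB.join hk hd' (hVB _ _ _ hψ) (hVB _ _ _ h') hcomp
        exact ⟨m.union m', ⟨stored_iff.2 ⟨χ, h1⟩, this.2.2.1⟩, rfl⟩

end MarkingNet

/-! ### Sums over sets of matches -/

/-- The sum of `f` over a set of matches. -/
noncomputable def matchSum {α : Type*} [Finite α] (S : Set α) (f : α → ℕ) : ℕ :=
  ∑ m ∈ S.toFinite.toFinset, f m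

theorem matchSum_mono {α : Type*} [Finite α] {S T : Set α} {f g : α → ℕ} (h : S ⊆ T)
    (hfg : ∀ m ∈ S, f m ≤ g m) : matchSum S f ≤ matchSum T g := by
  refine (Finset.sum_le_sum fun m hm => hfg m (by simpa using hm)).trans
    (Finset.sum_le_sum_of_subset (by simpa using h))

theorem list_sum_le_matchSum {α : Type*} [Finite α] {L : List α} (hL : L.Nodup) {S : Set α}
    (h : ∀ m ∈ L, m ∈ S) (f : α → ℕ) : (L.map f).sum ≤ matchSum S f := by
  classical
  rw [← List.sum_toFinset f hL]
  exact Finset.sum_le_sum_of_subset fun m hm => by simpa using h m (by simpa using hm)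

namespace MarkingNet

variable {TV TE VQ EQ VH EH ι : Type*} {TG : DirGraph TV TE}
  {Q : TypedGraph TG VQ EQ} {N : MarkingNet Q.toDirGraph ι} {H : TypedGraph TG VH EH}
  {Hp : Subgraph H.toDirGraph} {B : ι → Set (PMap VQ EQ VH EH)} {X : Set ℕ∞}

/-! ### Correctness of the handling of changes -/

/-- The invariant of the procedure, where `V n d` are the markings of the matches of `d` according
to the changes that `n` has handled. -/
structure Invariant (N : MarkingNet Q.toDirGraph ι) (H : TypedGraph TG VH EH)
    (Hp : Subgraph H.toDirGraph) (B : ι → Set (PMap VQ EQ VH EH)) (X : Set ℕ∞)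
    (V : ι → ι → PMap VQ EQ VH EH → Option ℕ∞) (s : Memory ι (PMap VQ EQ VH EH)) : Prop where
  logs : s.LogsValid
  inBounds : InBounds B s.marking
  log_values : ∀ d, ∀ c ∈ s.changes d, c.value ∈ X
  sound : ∀ n m ψ, s.marking n m = some ψ → ∃ φ, ψ ≤ φ ∧ (m, φ) ∈ N.candidates H Hp s.marking n
  view_dominated : ∀ n d, Dominated (V n d) (s.marking d)
  complete : ∀ n, (N.kind n = .vertexInput → s.loaded n = true) →
    ∀ a ∈ N.candidates H Hp (V n) n, Covers (s.marking n) a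

variable {V : ι → ι → PMap VQ EQ VH EH → Option ℕ∞} {s : Memory ι (PMap VQ EQ VH EH)}

theorem Invariant.values (h : N.Invariant H Hp B X V s) (n : ι) (m : PMap VQ EQ VH EH) (φ : ℕ∞)
    (e : s.marking n m = some φ) : φ ∈ X := by
  rw [← (h.logs n).2] at e
  obtain ⟨c, h1, -, rfl⟩ := exists_of_replay_eq_some e
  exact h.log_values n c h1

theorem Invariant.tick (h : N.Invariant H Hp B X V s) (k : ℕ) :
    N.Invariant H Hp B X V (s.tick k) := ⟨h.1, h.2, h.3, h.4, h.5, h.6⟩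

/-- Writing to `n` can only enlarge the candidates of the nodes depending on it, so their soundness
persists. Completeness refers to views, which do not move here. -/
theorem Invariant.writeAll (h : N.Invariant H Hp B X V s) {n : ι}
    {L : List (PMap VQ EQ VH EH × ℕ∞)}
    (hL : ∀ a ∈ L, a.1 ∈ B n ∧ a.2 ∈ X ∧ ∃ φ, a.2 ≤ φ ∧ (a.1, φ) ∈ N.candidates H Hp s.marking n) :
    N.Invariant H Hp B X V (s.writeAll n L) := by
  have hg := Memory.writeAll_grows n L s
  have old : ∀ k m φ, (s.writeAll n L).marking k m = some φ →
      s.marking k m = some φ ∨ (k = n ∧ (m, φ) ∈ L) := by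
    intro k m φ e
    by_cases hk : k = n
    · subst hk
      exact (Memory.writeAll_marking e).imp id fun h => ⟨rfl, h⟩
    · rw [hg.marking_of_ne k hk] at e
      exact Or.inl e
  refine ⟨h.logs.writeAll n L, ?_, ?_, ?_,
    fun k d => (h.view_dominated k d).trans (hg.dominated' d),
    fun k hk a ha => (h.complete k (by rwa [hg.loaded] at hk) a ha).mono (hg.dominated' k)⟩
  · intro k m φ e
    rcases old k m φ e with e' | ⟨rfl, e'⟩
    · exact h.inBounds k m φ e'
    · exact (hL _ e').1
  · intro k c hc
    by_cases hk : k = n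
    · subst hk
      rcases Memory.mem_writeAll_changes hc with h' | h'
      · exact h.log_values k c h'
      · exact (hL _ h').2.1
    · rw [hg.changes_of_ne k hk] at hc
      exact h.log_values k c hc
  · intro k m ψ e
    have : ∃ φ, ψ ≤ φ ∧ (m, φ) ∈ N.candidates H Hp s.marking k := by
      rcases old k m ψ e with e' | ⟨rfl, e'⟩
      · exact h.sound k m ψ e'
      · exact (hL _ e').2.2
    obtain ⟨φ, h1, h2⟩ := this
    obtain ⟨χ, h3, h4⟩ := candidates_mono hg.dominated' h2
    exact ⟨χ, h1.trans h3, h4⟩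

-- Advancing a view only imposes new obligations on `n`: the view must still lie below the
-- dependency, and the new candidates must be covered.
open Classical in
theorem Invariant.update_view (h : N.Invariant H Hp B X V s) {n d : ι}
    {g : PMap VQ EQ VH EH → Option ℕ∞} (hg : Dominated g (s.marking d))
    (hc : ∀ a ∈ N.candidates H Hp (Function.update (V n) d g) n, Covers (s.marking n) a) :
    N.Invariant H Hp B X (Function.update V n (Function.update (V n) d g)) s := by
  refine ⟨h.logs, h.inBounds, h.log_values, h.sound, fun k e => ?_, fun k hk => ?_⟩
  · by_cases hk : k = n
    · subst hk
      by_cases he : e = d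
      · subst he; simpa using hg
      · simpa [he] using h.view_dominated k e
    · simpa [hk] using h.view_dominated k e
  · by_cases hk' : k = n
    · subst hk'; simpa using hc
    · simpa [hk'] using h.complete k hk

theorem Invariant.covers_change (h : N.Invariant H Hp B X V s) {d : ι}
    {L : List (Change (PMap VQ EQ VH EH))} {c : Change (PMap VQ EQ VH EH)}
    (hp : L ++ [c] <+: s.changes d) : Covers (s.marking d) (c.item, c.value) := by
  obtain ⟨h1, h2⟩ := h.logs d
  rw [← h2]
  exact h1.covers hp

variable [Finite VQ] [Finite EQ] [Finite VH] [Finite EH]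

/-- An upper bound for the number of steps that `n` needs to handle the change `c` of `d`, in any
state. -/
noncomputable def cost (N : MarkingNet Q.toDirGraph ι) (B : ι → Set (PMap VQ EQ VH EH)) (n d : ι) :
    Change (PMap VQ EQ VH EH) → ℕ
  | .added m _ => m.size + matchSum (N.scope B n d m) fun m' => m'.size + 1
  | .raised m _ => 1 + matchSum (N.scope B n d m) fun _ => 1

/-- The offers are distinct and lie in the scope, so the state-dependent toll is at most a sum over
the whole scope. -/
theorem toll_le_cost (hB : N.Bounds H Hp B X) {s : Memory ι (PMap VQ EQ VH EH)}
    (hs : InBounds B s.marking) {n d : ι} (hd : d ∈ N.depList n)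
    {c : Change (PMap VQ EQ VH EH)} (hc : c.item ∈ B d) : N.toll H s n d c ≤ N.cost B n d c := by
  have h1 := offers_nodup (H := H) hB hs hd hc
  have h2 : ∀ m ∈ (N.offers H s n d c).map Prod.fst, m ∈ N.scope B n d c.item := by
    intro m hm
    obtain ⟨a, ha, rfl⟩ := List.mem_map.1 hm
    exact offers_mem_scope hB hs hd hc ha
  cases c with
  | added m φ =>
    have := list_sum_le_matchSum h1 h2 fun m' => m'.size + 1
    rw [List.map_map] at this
    exact Nat.add_le_add_left this _
  | raised m φ =>
    have := list_sum_le_matchSum h1 h2 fun _ => 1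
    simp only [offers, List.map_const', List.length_map, List.sum_replicate, smul_eq_mul,
      mul_one] at this
    exact Nat.add_le_add_left this _

open Classical in
theorem Invariant.handleChange (hB : N.Bounds H Hp B X) (h : N.Invariant H Hp B X V s) {n d : ι}
    (hd : d ∈ N.depList n) {L : List (Change (PMap VQ EQ VH EH))} {c : Change (PMap VQ EQ VH EH)}
    (hp : L ++ [c] <+: s.changes d) (hV : V n d = replay L) :
    N.Invariant H Hp B X (Function.update V n (Function.update (V n) d (replay (L ++ [c]))))
      (N.handleChange H n d s c) := by
  have hcov := h.covers_change hp
  have hcB : c.item ∈ B d := by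
    obtain ⟨χ, e, -⟩ := hcov
    exact h.inBounds _ _ _ e
  have hnv : N.kind n ≠ .vertexInput := by
    intro e
    simp [depList, e] at hd
  have hg := Memory.writeAll_grows n (N.offers H s n d c) s
  have hd' : d ≠ n := by
    rintro rfl
    exact (hB d).1 hd
  rw [handleChange_eq, replay_concat, ← hV]
  refine Invariant.tick (Invariant.update_view (h.writeAll fun a ha => ?_) ?_ ?_) _
  · exact ⟨scope_subset hB hd hcB (offers_mem_scope hB h.inBounds hd hcB ha),
      offers_value_mem hB h.values (h.log_values d c (hp.subset (by simp))) ha,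
      offers_sound hB h.inBounds hd (h.sound n) hcov ha⟩
  · rw [hg.marking_of_ne d hd', hV, ← replay_concat, ← (h.logs d).2]
    exact (h.logs d).1.replay_dominated hp
  · intro a ha
    refine offers_complete hB h.inBounds hd (h.view_dominated n) hcov ?_
      (h.complete n fun e => absurd e hnv) hg.dominated (Memory.writeAll_covers n _ s)
      (by convert ha)
    rw [hV]
    exact (h.logs d).1 L c hp

-- The counter `handled` jumps to the end of the log before the loop starts, so the view is carried
-- as a parameter `V` that follows the loop. As `n` does not depend on itself, the log being read
-- stays fixed.
open Classical in
theorem Invariant.foldl_handleChange (hB : N.Bounds H Hp B X)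
    {n d : ι} (hd : d ∈ N.depList n)
    {L P : List (Change (PMap VQ EQ VH EH))} (h : N.Invariant H Hp B X V s)
    (he : s.changes d = L ++ P) (hV : V n d = replay L) :
    N.Invariant H Hp B X (Function.update V n (Function.update (V n) d (replay (L ++ P))))
        (P.foldl (N.handleChange H n d) s) ∧
      Memory.Grows n s (P.foldl (N.handleChange H n d) s) ∧
      (P.foldl (N.handleChange H n d) s).steps ≤ s.steps + (P.map (N.cost B n d)).sum := by
  induction P generalizing L V s with
  | nil =>
    refine ⟨?_, Memory.Grows.refl n s, by simp⟩
    rw [List.append_nil, ← hV, Function.update_eq_self, Function.update_eq_self]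
    exact h
  | cons c P ih =>
    have hd' : d ≠ n := by
      rintro rfl
      exact (hB d).1 hd
    have hp : L ++ [c] <+: s.changes d := ⟨P, by rw [he]; simp⟩
    have h1 := h.handleChange hB hd hp hV
    have hg : Memory.Grows n s (N.handleChange H n d s c) := by
      rw [handleChange_eq]
      exact (Memory.writeAll_grows n _ s).tick _
    have hch := hg.changes_of_ne d hd'
    obtain ⟨i1, i2, i3⟩ := ih (s := N.handleChange H n d s c) (L := L ++ [c])
      h1 (by rw [hch, he]; simp) (by simp)
    refine ⟨?_, hg.trans i2, i3.trans ?_⟩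
    · simpa using i1
    · have hcB : c.item ∈ B d := by
        obtain ⟨χ, e, -⟩ := h.covers_change hp
        exact h.inBounds _ _ _ e
      have := toll_le_cost (H := H) hB h.inBounds hd hcB
      have e : (N.handleChange H n d s c).steps = s.steps + N.toll H s n d c := by
        rw [handleChange_eq]
        change (Memory.writeAll n _ s).steps + _ = _
        rw [Memory.writeAll_steps]
      rw [e, List.map_cons, List.sum_cons]
      omega

end MarkingNet

/-! ### Views of dependencies and the effect of executing one node -/

namespace Memory

variable {ι M : Type*}

/-- The markings of the matches of `d` according to the changes that `n` has handled. -/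
noncomputable def view (s : Memory ι M) (n d : ι) : M → Option ℕ∞ :=
  replay ((s.changes d).take (s.handled n d))

/-- The state `s'` arises from `s` by an execution of the node `n`. -/
structure Advances (n : ι) (s s' : Memory ι M) : Prop where
  marking_of_ne : ∀ k, k ≠ n → s'.marking k = s.marking k
  changes_of_ne : ∀ k, k ≠ n → s'.changes k = s.changes k
  isPrefix : s.changes n <+: s'.changes n
  handled_of_ne : ∀ k, k ≠ n → s'.handled k = s.handled k
  loaded_of_ne : ∀ k, k ≠ n → s'.loaded k = s.loaded k

theorem Advances.refl (n : ι) (s : Memory ι M) : Advances n s s :=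
  ⟨fun _ _ => rfl, fun _ _ => rfl, List.prefix_refl _, fun _ _ => rfl, fun _ _ => rfl⟩

theorem Advances.trans {n : ι} {s s' s'' : Memory ι M} (h : Advances n s s')
    (h' : Advances n s' s'') : Advances n s s'' where
  marking_of_ne k hk := (h'.marking_of_ne k hk).trans (h.marking_of_ne k hk)
  changes_of_ne k hk := (h'.changes_of_ne k hk).trans (h.changes_of_ne k hk)
  isPrefix := h.isPrefix.trans h'.isPrefix
  handled_of_ne k hk := (h'.handled_of_ne k hk).trans (h.handled_of_ne k hk)
  loaded_of_ne k hk := (h'.loaded_of_ne k hk).trans (h.loaded_of_ne k hk)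

theorem Advances.isPrefix' {n : ι} {s s' : Memory ι M} (h : Advances n s s') (k : ι) :
    s.changes k <+: s'.changes k := by
  by_cases hk : k = n
  · subst hk; exact h.isPrefix
  · rw [h.changes_of_ne k hk]

/-- Logs grow only at the end, so the part already handled by a node, and with it its view and its
charge, is unaffected by later changes. -/
theorem take_eq_of_isPrefix {α : Type*} {L L' : List α} (h : L <+: L') {k : ℕ} (hk : k ≤ L.length) :
    L'.take k = L.take k := by
  obtain ⟨t, rfl⟩ := h
  exact List.take_append_of_le_length hk

end Memory

namespace MarkingNet

variable {TV TE VQ EQ VH EH ι : Type*} {TG : DirGraph TV TE}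
  {Q : TypedGraph TG VQ EQ} {N : MarkingNet Q.toDirGraph ι} {H : TypedGraph TG VH EH}
  {Hp : Subgraph H.toDirGraph} {B : ι → Set (PMap VQ EQ VH EH)} {X : Set ℕ∞}

/-! ### Execution of nodes -/

/-- A state that can be reached by the procedure. -/
structure Reachable (N : MarkingNet Q.toDirGraph ι) (H : TypedGraph TG VH EH)
    (Hp : Subgraph H.toDirGraph) (B : ι → Set (PMap VQ EQ VH EH)) (X : Set ℕ∞)
    (s : Memory ι (PMap VQ EQ VH EH)) : Prop where
  invariant : N.Invariant H Hp B X s.view s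
  handled_le : ∀ n d, s.handled n d ≤ (s.changes d).length

theorem reachable_empty : N.Reachable H Hp B X (Memory.empty : Memory ι (PMap VQ EQ VH EH)) := by
  refine ⟨⟨fun d => ⟨validLog_nil, rfl⟩, fun n m φ h => by simp [Memory.empty] at h,
    fun d c h => by simp [Memory.empty] at h, fun n m φ h => by simp [Memory.empty] at h,
    fun n d m φ h => by simp [Memory.view, Memory.empty, replay] at h, fun n hn a ha => ?_⟩,
    fun n d => by simp [Memory.empty]⟩
  exfalso
  have hv : ∀ d m, (Memory.empty : Memory ι (PMap VQ EQ VH EH)).view n d m = none := by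
    intro d m
    simp [Memory.view, Memory.empty, replay]
  have hl : (Memory.empty : Memory ι (PMap VQ EQ VH EH)).loaded n = false := rfl
  -- Empty views yield no candidates, and a vertex input owes nothing before it is loaded.
  cases hk : N.kind n <;> simp [candidates, hk, hv, hl] at ha hn

variable [Finite VQ] [Finite EQ] [Finite VH] [Finite EH]

/-- The steps charged to the changes of `d` that `n` has handled. -/
noncomputable def depCharge (N : MarkingNet Q.toDirGraph ι) (B : ι → Set (PMap VQ EQ VH EH))
    (s : Memory ι (PMap VQ EQ VH EH)) (n d : ι) : ℕ :=
  (((s.changes d).take (s.handled n d)).map fun c => 1 + N.cost B n d c).sum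

open Classical in
/-- The steps charged to the execution of `n` so far. -/
noncomputable def nodeCharge (N : MarkingNet Q.toDirGraph ι) (B : ι → Set (PMap VQ EQ VH EH))
    (s : Memory ι (PMap VQ EQ VH EH)) (n : ι) : ℕ :=
  ∑ d ∈ (N.depList n).toFinset, N.depCharge B s n d +
    if N.kind n = .vertexInput ∧ s.loaded n = true then matchSum (B n) fun m => m.size + 1 else 0

/-- A charge concerns only changes already handled; new log entries written by another node cost
nothing until they are read. -/
theorem nodeCharge_of_ne {s s' : Memory ι (PMap VQ EQ VH EH)} {n k : ι}
    (hs : N.Reachable H Hp B X s) (h : Memory.Advances n s s') (hk : k ≠ n) :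
    N.nodeCharge B s' k = N.nodeCharge B s k := by
  unfold nodeCharge depCharge
  rw [h.loaded_of_ne k hk, h.handled_of_ne k hk]
  congr 1
  refine Finset.sum_congr rfl fun d _ => ?_
  rw [Memory.take_eq_of_isPrefix (h.isPrefix' d) (hs.handled_le k d)]

-- The last clause is the amortized form of the cost bound: the steps taken are at most the growth
-- of the charge for the pair `n`, `d`. In this form it telescopes over repeated executions.
open Classical in
theorem handleDep_spec (hB : N.Bounds H Hp B X) {s : Memory ι (PMap VQ EQ VH EH)}
    (hs : N.Reachable H Hp B X s) {n d : ι} (hd : d ∈ N.depList n) :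
    N.Reachable H Hp B X (N.handleDep H n s d) ∧ Memory.Advances n s (N.handleDep H n s d) ∧
      (N.handleDep H n s d).handled n d = (s.changes d).length ∧
      (∀ e, e ≠ d → (N.handleDep H n s d).handled n e = s.handled n e) ∧
      (N.handleDep H n s d).loaded = s.loaded ∧
      (N.handleDep H n s d).steps + N.depCharge B s n d ≤
        s.steps + N.depCharge B (N.handleDep H n s d) n d := by
  have hd' : d ≠ n := by
    rintro rfl
    exact (hB d).1 hd
  unfold handleDep
  dsimp only
  split_ifs with hp
  · refine ⟨hs, Memory.Advances.refl n s, ?_, fun _ _ => rfl, rfl, le_rfl⟩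
    have := List.drop_eq_nil_iff.1 hp
    exact le_antisymm (hs.handled_le n d) this
  · set P := (s.changes d).drop (s.handled n d) with hP
    set s₁ : Memory ι (PMap VQ EQ VH EH) :=
      { s.tick 1 with
        handled := Function.update s.handled n
          (Function.update (s.handled n) d (s.changes d).length) } with hs₁
    -- The counter has already moved, but the invariant is kept for the old view until the loop has
    -- processed the pending changes.
    have hinv : N.Invariant H Hp B X s.view s₁ :=
      ⟨hs.1.1, hs.1.2, hs.1.3, hs.1.4, hs.1.5, hs.1.6⟩
    have he : s.changes d = (s.changes d).take (s.handled n d) ++ P :=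
      (List.take_append_drop _ _).symm
    obtain ⟨i1, i2, i3⟩ := hinv.foldl_handleChange hB hd he rfl
    rw [← he] at i1
    set s' := P.foldl (N.handleChange H n d) s₁ with hs'
    have hch : s'.changes d = s.changes d := i2.changes_of_ne d hd'
    have hpre : ∀ k, s.changes k <+: s'.changes k := i2.isPrefix'
    have hadv : Memory.Advances n s s' :=
      ⟨i2.marking_of_ne, i2.changes_of_ne, i2.isPrefix,
        fun k hk => by rw [i2.handled]; simp [s₁, hk], fun k _ => by rw [i2.loaded]; rfl⟩
    have hnd : s'.handled n d = (s.changes d).length := by rw [i2.handled]; simp [s₁]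
    have hne : ∀ e, e ≠ d → s'.handled n e = s.handled n e := fun e he => by
      rw [i2.handled]; simp [s₁, he]
    refine ⟨⟨?_, fun k e => ?_⟩, hadv, hnd, hne, i2.loaded, ?_⟩
    · convert i1 using 1
      funext k e
      by_cases hk : k = n
      · subst hk
        by_cases hed : e = d
        · subst hed
          simp [Memory.view, hnd, hch]
        · simp only [Function.update_self, Function.update_of_ne hed, Memory.view, hne e hed]
          rw [Memory.take_eq_of_isPrefix (hpre e) (hs.handled_le k e)]
      · simp only [Function.update_of_ne hk, Memory.view, hadv.handled_of_ne k hk]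
        rw [Memory.take_eq_of_isPrefix (hpre e) (hs.handled_le k e)]
    · by_cases hke : k = n ∧ e = d
      · obtain ⟨rfl, rfl⟩ := hke
        rw [hnd, hch]
      · refine le_trans ?_ ((hs.handled_le k e).trans (hpre e).length_le)
        by_cases hk : k = n
        · subst hk
          exact (hne e fun h => hke ⟨rfl, h⟩).le
        · rw [hadv.handled_of_ne k hk]
    · have e1 : N.depCharge B s' n d =
          N.depCharge B s n d + (P.length + (P.map (N.cost B n d)).sum) := by
        have : ∀ L : List (Change (PMap VQ EQ VH EH)),
            (L.map fun c => 1 + N.cost B n d c).sum = L.length + (L.map (N.cost B n d)).sum := by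
          intro L
          induction L with
          | nil => simp
          | cons c L ih => simp only [List.map_cons, List.sum_cons, List.length_cons, ih]; omega
        unfold depCharge
        rw [hnd, hch, List.take_length]
        conv_lhs => rw [he, List.map_append, List.sum_append, this P]
      have e2 : s₁.steps = s.steps + 1 := rfl
      -- The notification costs one step, and there is at least one pending change; the extra `1` in
      -- its charge pays for it.
      have e3 : 0 < P.length := List.length_pos_iff.2 hp
      rw [e1]
      omega

open Classical in
theorem foldl_handleDep_spec (hB : N.Bounds H Hp B X) {n : ι} (D : List ι)
    (hD : ∀ d ∈ D, d ∈ N.depList n) {s : Memory ι (PMap VQ EQ VH EH)}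
    (hs : N.Reachable H Hp B X s) :
    N.Reachable H Hp B X (D.foldl (N.handleDep H n) s) ∧
      Memory.Advances n s (D.foldl (N.handleDep H n) s) ∧
      (∀ d ∈ N.depList n, d ∈ D ∨ s.handled n d = (s.changes d).length →
        (D.foldl (N.handleDep H n) s).handled n d = (s.changes d).length) ∧
      (D.foldl (N.handleDep H n) s).steps + N.nodeCharge B s n ≤
        s.steps + N.nodeCharge B (D.foldl (N.handleDep H n) s) n := by
  induction D generalizing s with
  | nil => exact ⟨hs, Memory.Advances.refl n s, fun d _ h => by simpa using h, le_rfl⟩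
  | cons d D ih =>
    have hd := hD d (by simp)
    obtain ⟨h1, h2, h3, h4, h5, h6⟩ := handleDep_spec (H := H) hB hs hd
    obtain ⟨i1, i2, i3, i4⟩ := ih (fun e he => hD e (by simp [he])) h1
    refine ⟨i1, h2.trans i2, fun e he h => ?_, ?_⟩
    · have hen : e ≠ n := by
        rintro rfl
        exact (hB e).1 he
      have i3e := i3 e he
      rw [h2.changes_of_ne e hen] at i3e
      refine i3e ?_
      by_cases hed : e = d
      · subst hed
        exact Or.inr h3
      · rw [h4 e hed]
        simpa [hed] using h
    · have : (N.handleDep H n s d).steps + N.nodeCharge B s n ≤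
          s.steps + N.nodeCharge B (N.handleDep H n s d) n := by
        unfold nodeCharge
        rw [h5]
        have hmem : d ∈ (N.depList n).toFinset := by simpa using hd
        rw [← Finset.add_sum_erase _ _ hmem, ← Finset.add_sum_erase _ _ hmem]
        have : ∑ x ∈ (N.depList n).toFinset.erase d, N.depCharge B (N.handleDep H n s d) n x =
            ∑ x ∈ (N.depList n).toFinset.erase d, N.depCharge B s n x := by
          refine Finset.sum_congr rfl fun x hx => ?_
          simp only [Finset.mem_erase, List.mem_toFinset] at hx
          unfold depCharge
          rw [h4 x hx.1, Memory.take_eq_of_isPrefix (h2.isPrefix' x) (hs.handled_le n x)]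
        rw [this]
        omega
      simp only [List.foldl_cons]
      omega

theorem runNode_eq {s : Memory ι (PMap VQ EQ VH EH)} {n : ι} (hn : N.kind n ≠ .vertexInput) :
    N.runNode H Hp s n = (N.depList n).foldl (N.handleDep H n) s := by
  unfold runNode depList
  cases hk : N.kind n <;> simp_all

/-- Executing a node keeps the invariant, brings the node up to date with its dependencies, and
takes no more steps than are charged. -/
theorem runNode_spec (hB : N.Bounds H Hp B X) {s : Memory ι (PMap VQ EQ VH EH)}
    (hs : N.Reachable H Hp B X s) (n : ι) :
    N.Reachable H Hp B X (N.runNode H Hp s n) ∧ Memory.Advances n s (N.runNode H Hp s n) ∧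
      (N.kind n = .vertexInput → (N.runNode H Hp s n).loaded n = true) ∧
      (∀ d ∈ N.depList n, (N.runNode H Hp s n).view n d = s.marking d) ∧
      (N.runNode H Hp s n).steps + N.nodeCharge B s n ≤
        s.steps + N.nodeCharge B (N.runNode H Hp s n) n := by
  by_cases hk : N.kind n = .vertexInput
  · have hdep : N.depList n = [] := by simp [depList, hk]
    by_cases hl : s.loaded n = true
    · have e : N.runNode H Hp s n = s := by simp [runNode, hk, hl]
      rw [e]
      exact ⟨hs, Memory.Advances.refl n s, fun _ => hl, by simp [hdep], le_rfl⟩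
    · have hbound := (hB n).2
      simp only [hk] at hbound
      classical
      set L := (enumerate (allMatches Q H (N.query n) Hp)).map fun m => (m, (⊤ : ℕ∞)) with hL
      set s₁ : Memory ι (PMap VQ EQ VH EH) :=
        { s with loaded := Function.update s.loaded n true } with hs₁
      have e : N.runNode H Hp s n =
          (s₁.writeAll n L).tick (L.map fun a => a.1.size + 1).sum := by
        rw [← offerAll_eq]
        simp only [runNode, hk, hl]
        rfl
      have hcand : ∀ C, N.candidates H Hp C n =
          {a | a.1 ∈ allMatches Q H (N.query n) Hp ∧ a.2 = ⊤} := fun C => by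
        simp [candidates, hk]
      have hg := Memory.writeAll_grows n L s₁
      have hmem : ∀ a ∈ L, a.1 ∈ allMatches Q H (N.query n) Hp ∧ a.2 = ⊤ := by
        intro a ha
        obtain ⟨m, h1, rfl⟩ := List.mem_map.1 ha
        exact ⟨mem_enumerate.1 h1, rfl⟩
      have hinv : N.Invariant H Hp B X s.view ((s₁.writeAll n L).tick
          (L.map fun a => a.1.size + 1).sum) := by
        -- The matches are written while the node still counts as not loaded, so its completeness is
        -- vacuous. The flag is set afterwards, when all vertex matches are covered.
        have h0 : N.Invariant H Hp B X (fun k d => if k = n then fun _ => none else s.view k d)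
            (s.writeAll n L) := by
          refine Invariant.writeAll ⟨hs.1.1, hs.1.2, hs.1.3, hs.1.4, fun k d => ?_,
            fun k hkl a ha => ?_⟩ fun a ha => ?_
          · by_cases hkn : k = n
            · intro m φ h; simp [hkn] at h
            · simpa [hkn] using hs.1.5 k d
          · by_cases hkn : k = n
            · subst hkn
              exact absurd (hkl hk) hl
            · simp only [hkn, if_false] at ha
              exact hs.1.6 k hkl a ha
          · obtain ⟨h1, h2⟩ := hmem a ha
            exact ⟨hbound.1 h1, h2 ▸ hbound.2, ⊤, le_top, by rw [hcand]; exact ⟨h1, rfl⟩⟩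
        have hwm : ∀ (L : List (PMap VQ EQ VH EH × ℕ∞)) (s : Memory ι (PMap VQ EQ VH EH)) f,
            Memory.writeAll n L { s with loaded := f } =
              { Memory.writeAll n L s with loaded := f } := by
          intro L
          induction L with
          | nil => intro s f; rfl
          | cons a L ih =>
            intro s f
            change Memory.writeAll n L (Memory.write _ n a.1 a.2) = _
            have : Memory.write { s with loaded := f } n a.1 a.2 =
                { s.write n a.1 a.2 with loaded := f } := by
              unfold Memory.write
              dsimp only
              cases s.marking n a.1 with
              | none => rfl
              | some ψ => dsimp only; split_ifs <;> rfl
            rw [this, ih]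
            rfl
        rw [hs₁, hwm]
        refine ⟨h0.1, h0.2, h0.3, h0.4, fun k d => ?_, fun k hkl a ha => ?_⟩
        · exact (hs.1.5 k d).trans ((Memory.writeAll_grows n L s).dominated' d)
        · by_cases hkn : k = n
          · subst hkn
            rw [hcand] at ha
            refine Memory.writeAll_covers k L s a (List.mem_map.2 ⟨a.1, mem_enumerate.2 ha.1, ?_⟩)
            exact Prod.ext rfl ha.2.symm
          · have := h0.complete k (fun hk' => by
              have := hkl hk'
              simp only [Memory.tick, Function.update_of_ne hkn] at this
              rw [(Memory.writeAll_grows n L s).loaded]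
              exact this) a (by simpa [hkn] using ha)
            exact this
      rw [e]
      have hadv : Memory.Advances n s ((s₁.writeAll n L).tick
          (L.map fun a => a.1.size + 1).sum) :=
        ⟨hg.1, hg.2, hg.6, fun k _ => by
            change (s₁.writeAll n L).handled k = _
            rw [hg.3],
          fun k hkn => by
            change (s₁.writeAll n L).loaded k = _
            rw [hg.4]
            simp [s₁, hkn]⟩
      have hload : ((s₁.writeAll n L).tick (L.map fun a => a.1.size + 1).sum).loaded n = true := by
        change (s₁.writeAll n L).loaded n = true
        rw [hg.4]
        simp [s₁]
      have hhan : ((s₁.writeAll n L).tick (L.map fun a => a.1.size + 1).sum).handled = s.handled :=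
        hg.3
      refine ⟨⟨?_, fun k d => ?_⟩, hadv, fun _ => hload, by simp [hdep], ?_⟩
      · convert hinv using 1
        funext k d
        simp only [Memory.view]
        rw [hhan, Memory.take_eq_of_isPrefix (hadv.isPrefix' d) (hs.handled_le k d)]
      · rw [hhan]
        exact (hs.handled_le k d).trans (hadv.isPrefix' d).length_le
      · simp only [nodeCharge, hdep, hk, hload, hl, List.toFinset_nil, Finset.sum_empty]
        have h1 : (s₁.writeAll n L).steps = s.steps := Memory.writeAll_steps n L s₁
        simp only [Memory.tick, h1]
        have h2 : (L.map fun a => a.1.size + 1).sum ≤ matchSum (B n) fun m => m.size + 1 := by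
          rw [hL, List.map_map]
          exact list_sum_le_matchSum (nodup_enumerate _)
            (fun m hm => hbound.1 (mem_enumerate.1 hm)) fun m => m.size + 1
        simpa using h2
  · rw [runNode_eq hk]
    obtain ⟨h1, h2, h3, h4⟩ := foldl_handleDep_spec (H := H) hB (N.depList n) (fun _ h => h) hs
    refine ⟨h1, h2, fun h => absurd h hk, fun d hd => ?_, h4⟩
    have hdn : d ≠ n := by
      rintro rfl
      exact (hB d).1 hd
    rw [Memory.view, h3 d hd (Or.inl hd), h2.changes_of_ne d hdn, List.take_length]
    exact (hs.1.logs d).2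

-- After execution the view of `n` is the current state of its dependencies. Completeness makes the
-- stored marking an upper bound of the candidates, and soundness puts it below one of them; so it
-- is their maximum, which is the target result.
open Classical in
theorem runNode_config (hB : N.Bounds H Hp B X) {s : Memory ι (PMap VQ EQ VH EH)}
    (hs : N.Reachable H Hp B X s) (n : ι) :
    (N.runNode H Hp s n).config =
      Function.update s.config n (N.results H Hp s.config n) := by
  obtain ⟨h1, h2, h3, h4, -⟩ := runNode_spec hB hs n
  set s' := N.runNode H Hp s n
  have hdn : ∀ d ∈ N.depList n, d ≠ n := by
    rintro d hd rfl
    exact (hB d).1 hd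
  have c1 : N.candidates H Hp (s'.view n) n = N.candidates H Hp s.marking n :=
    candidates_congr h4
  have c2 : N.candidates H Hp s'.marking n = N.candidates H Hp s.marking n :=
    candidates_congr fun d hd => h2.marking_of_ne d (hdn d hd)
  have hres : N.results H Hp s.config n =
      {a | IsGreatest {φ | (a.1, φ) ∈ N.candidates H Hp s.marking n} a.2} :=
    results_eq_candidates hB hs.1.inBounds n
  have complete := h1.1.complete n h3
  have sound := h1.1.sound n
  rw [c1] at complete
  rw [c2] at sound
  funext k
  by_cases hk : k = n
  · subst hk
    rw [Function.update_self, hres]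
    ext ⟨m, φ⟩
    change s'.marking k m = some φ ↔ IsGreatest _ φ
    constructor
    · intro e
      have up : ∀ ψ, (m, ψ) ∈ N.candidates H Hp s.marking k → ψ ≤ φ := by
        intro ψ hψ
        obtain ⟨χ, h5, h6⟩ := complete _ hψ
        rw [e] at h5
        cases h5
        exact h6
      obtain ⟨ψ, h5, h6⟩ := sound m φ e
      exact ⟨(le_antisymm h5 (up ψ h6)) ▸ h6, up⟩
    · rintro ⟨h5, h6⟩
      obtain ⟨ψ, h7, h8⟩ := complete _ h5
      obtain ⟨χ, h9, h10⟩ := sound m ψ h7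
      rw [h7, le_antisymm (h9.trans (h6 h10)) h8]
  · rw [Function.update_of_ne hk]
    simp only [Memory.config]
    rw [h2.marking_of_ne k hk]

/-- Steps minus total charge never increases, since each execution changes only the charge of its
own node. This is why executing a left subtree twice does not double the bound. -/
theorem foldl_runNode_spec (hB : N.Bounds H Hp B X) (O : List ι) (hO : ∀ n ∈ O, n ∈ N.nodes)
    {s : Memory ι (PMap VQ EQ VH EH)} (hs : N.Reachable H Hp B X s) :
    N.Reachable H Hp B X (O.foldl (N.runNode H Hp) s) ∧
      (O.foldl (N.runNode H Hp) s).config = N.execute H Hp O s.config ∧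
      (O.foldl (N.runNode H Hp) s).steps + ∑ n ∈ N.nodes, N.nodeCharge B s n ≤
        s.steps + ∑ n ∈ N.nodes, N.nodeCharge B (O.foldl (N.runNode H Hp) s) n := by
  classical
  induction O generalizing s with
  | nil => exact ⟨hs, rfl, le_rfl⟩
  | cons n O ih =>
    obtain ⟨h1, h2, -, -, h5⟩ := runNode_spec hB hs n
    obtain ⟨i1, i2, i3⟩ := ih (fun k hk => hO k (by simp [hk])) h1
    refine ⟨i1, ?_, ?_⟩
    · rw [List.foldl_cons, i2, runNode_config hB hs n]
      rfl
    · have hn := hO n (by simp)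
      rw [← Finset.add_sum_erase _ _ hn] at i3 ⊢
      rw [← Finset.add_sum_erase _ _ hn] at i3 ⊢
      have : ∑ k ∈ N.nodes.erase n, N.nodeCharge B (N.runNode H Hp s n) k =
          ∑ k ∈ N.nodes.erase n, N.nodeCharge B s k :=
        Finset.sum_congr rfl fun k hk => nodeCharge_of_ne hs h2 (Finset.ne_of_mem_erase hk)
      rw [this] at i3
      simp only [List.foldl_cons]
      omega

/-- The incremental procedure computes the results of the execution, and the number of its steps is
at most the sum of the charges of the nodes. -/
theorem run_spec (hB : N.Bounds H Hp B X) (O : List ι) (hO : ∀ n ∈ O, n ∈ N.nodes) :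
    N.Reachable H Hp B X (N.run H Hp O) ∧
      (N.run H Hp O).config = N.execute H Hp O (fun _ => ∅) ∧
      (N.run H Hp O).steps ≤ ∑ n ∈ N.nodes, N.nodeCharge B (N.run H Hp O) n := by
  obtain ⟨h1, h2, h3⟩ := foldl_runNode_spec hB O hO reachable_empty
  refine ⟨h1, ?_, ?_⟩
  · have : (Memory.empty : Memory ι (PMap VQ EQ VH EH)).config = fun _ => ∅ := by
      funext n
      ext a
      simp [Memory.config, Memory.empty]
    rw [← this]
    exact h2
  · have : (Memory.empty : Memory ι (PMap VQ EQ VH EH)).steps = 0 := rfl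
    rw [this, Nat.zero_add] at h3
    exact (Nat.le_add_right _ _).trans h3

end MarkingNet

/-! ### The number of changes -/

/-- The markings `0, …, h` and `∞`. -/
def markingValues (h : ℕ) : Set ℕ∞ := {φ | φ = ⊤ ∨ φ ≤ h}

/-- The position of a marking in `0, …, h, ∞`, counted from `1`. -/
noncomputable def markingRank (h : ℕ) : ℕ∞ → ℕ
  | ⊤ => h + 2
  | (k : ℕ) => k + 1

theorem markingRank_le {h : ℕ} {φ : ℕ∞} (hφ : φ ∈ markingValues h) : markingRank h φ ≤ h + 2 := by
  cases φ with
  | top => exact le_rfl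
  | coe k =>
    have : k ≤ h := by simpa [markingValues] using hφ
    change k + 1 ≤ h + 2
    omega

/-- The rank turns strict increase of markings into strict increase of a number at most `h + 2`,
which limits the number of raises. -/
theorem markingRank_lt {h : ℕ} {φ ψ : ℕ∞} (hφ : φ ∈ markingValues h) (hlt : φ < ψ) :
    markingRank h φ < markingRank h ψ := by
  cases φ with
  | top => simp at hlt
  | coe k =>
    have hk : k ≤ h := by simpa [markingValues] using hφ
    cases ψ with
    | top => change k + 1 < h + 2; omega
    | coe l =>
      have : k < l := by exact_mod_cast hlt
      change k + 1 < l + 1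
      omega

/-- A sum over the changes in a valid log: every match is added once, and its marking is increased
at most as often as there are markings. -/
theorem ValidLog.sum_le {M : Type*} [Finite M] {h : ℕ} {L : List (Change M)} (hL : ValidLog L)
    (hX : ∀ c ∈ L, c.value ∈ markingValues h) {S : Set M} (hS : ∀ c ∈ L, c.item ∈ S)
    {f : Change M → ℕ} {a b : M → ℕ} (ha : ∀ m φ, f (.added m φ) ≤ a m)
    (hb : ∀ m φ, f (.raised m φ) ≤ b m) :
    (L.map f).sum ≤ matchSum S fun m => a m + (h + 2) * b m := by
  classical
  -- A potential: a match now marked `φ` has paid `a m` for its insertion and at most `b m` for each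
  -- rank it has reached.
  let g : M → Option ℕ∞ → ℕ := fun m o => o.elim 0 fun φ => a m + markingRank h φ * b m
  have key : (L.map f).sum ≤ matchSum S fun m => g m (replay L m) := by
    induction L using List.reverseRecOn with
    | nil => simp
    | append_singleton L c ih =>
      have ih := ih (hL.of_isPrefix (List.prefix_append _ _)) (fun c hc => hX c (by simp [hc]))
        fun c hc => hS c (by simp [hc])
      have hfit := hL L c (List.prefix_refl _)
      have hcS : c.item ∈ S.toFinite.toFinset := by simpa using hS c (by simp)
      rw [List.map_append, List.sum_append, List.map_singleton, List.sum_singleton, replay_concat]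
      unfold matchSum at ih ⊢
      rw [← Finset.add_sum_erase _ _ hcS] at ih ⊢
      have e : ∑ m ∈ S.toFinite.toFinset.erase c.item,
          g m (Function.update (replay L) c.item (some c.value) m) =
          ∑ m ∈ S.toFinite.toFinset.erase c.item, g m (replay L m) :=
        Finset.sum_congr rfl fun m hm => by
          rw [Function.update_of_ne (Finset.ne_of_mem_erase hm)]
      have step : f c + g c.item (replay L c.item) ≤ g c.item (some c.value) := by
        cases c with
        | added m φ =>
          have h1 : replay L m = none := hfit
          simp only [Change.item, Change.value, h1, g, Option.elim]
          have := ha m φ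
          omega
        | raised m φ =>
          obtain ⟨ψ, h1, h2⟩ := hfit
          obtain ⟨c', h3, -, h5⟩ := exists_of_replay_eq_some h1
          have h6 := markingRank_lt (h5 ▸ hX c' (by simp [h3])) h2
          simp only [Change.item, Change.value, h1, g, Option.elim]
          have h7 := hb m φ
          -- A raise climbs at least one rank, and that one unit of `b m` pays for it.
          have h8 := Nat.mul_le_mul_right (b m) (Nat.succ_le_of_lt h6)
          rw [Nat.succ_mul] at h8
          omega
      simp only [Function.update_self]
      rw [e]
      omega
  refine key.trans (matchSum_mono subset_rfl fun m _ => ?_)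
  cases e : replay L m with
  | none => exact Nat.zero_le _
  | some φ =>
    obtain ⟨c, h1, -, h2⟩ := exists_of_replay_eq_some e
    exact Nat.add_le_add_left (Nat.mul_le_mul_right _ (markingRank_le (h2 ▸ hX c h1))) _

/-! ### The charges of the nodes -/

/-- The sum of the sizes of the matches in `S`, each increased by `q`. -/
noncomputable def weight {VQ EQ VH EH : Type*} [Finite VQ] [Finite EQ] [Finite VH] [Finite EH]
    (q : ℕ) (S : Set (PMap VQ EQ VH EH)) : ℕ :=
  matchSum S fun m => m.size + q

theorem matchSum_add {α : Type*} [Finite α] (S : Set α) (f g : α → ℕ) :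
    matchSum S (fun m => f m + g m) = matchSum S f + matchSum S g := Finset.sum_add_distrib

theorem matchSum_mul {α : Type*} [Finite α] (S : Set α) (k : ℕ) (f : α → ℕ) :
    matchSum S (fun m => k * f m) = k * matchSum S f := (Finset.mul_sum _ _ _).symm

theorem matchSum_singleton {α : Type*} [Finite α] (m : α) (f : α → ℕ) :
    matchSum {m} f = f m := by
  simp [matchSum]

/-- Fibres over different matches are disjoint. For joins and navigation nodes this prevents a
result from being counted once per dependency match. -/
theorem matchSum_fiber_le {α β : Type*} [Finite α] [Finite β] (S : Set α) (T : Set β) (r : β → α)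
    (f : β → ℕ) : matchSum S (fun m => matchSum {m' | m' ∈ T ∧ r m' = m} f) ≤ matchSum T f := by
  classical
  have : ∀ m, ({m' | m' ∈ T ∧ r m' = m} : Set β).toFinite.toFinset =
      T.toFinite.toFinset.filter fun m' => r m' = m := by
    intro m
    ext x
    simp
  simp only [matchSum, this]
  refine (Finset.sum_fiberwise_eq_sum_filter _ _ r f).le.trans ?_
  exact Finset.sum_le_sum_of_subset (Finset.filter_subset _ _)

namespace MarkingNet

variable {TV TE VQ EQ VH EH ι : Type*} {TG : DirGraph TV TE}
  [Finite VQ] [Finite EQ] [Finite VH] [Finite EH]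
  {Q : TypedGraph TG VQ EQ} {N : MarkingNet Q.toDirGraph ι} {H : TypedGraph TG VH EH}
  {Hp : Subgraph H.toDirGraph} {B : ι → Set (PMap VQ EQ VH EH)}
  {s : Memory ι (PMap VQ EQ VH EH)} {h q : ℕ}

/-- Insertion and up to `h + 2` raises charge a match `1 + |m| + 2(h + 2)`, at most `3(|m| + q)`,
and charge each result in its scope `|m'| + 1 + (h + 2)`, at most `2(|m'| + q)`. -/
theorem depCharge_le_scope (hs : N.Reachable H Hp B (markingValues h) s) (hq : h + 2 ≤ q)
    (n d : ι) : N.depCharge B s n d ≤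
      3 * weight q (B d) + 2 * matchSum (B d) fun m => weight q (N.scope B n d m) := by
  have hsub : ∀ c ∈ (s.changes d).take (s.handled n d), c ∈ s.changes d :=
    fun c hc => List.mem_of_mem_take hc
  have hitem : ∀ c ∈ (s.changes d).take (s.handled n d), c.item ∈ B d := by
    intro c hc
    obtain ⟨L, L', e⟩ := List.append_of_mem (hsub c hc)
    obtain ⟨χ, h1, -⟩ := hs.1.covers_change (d := d) (L := L) (c := c) ⟨L', by simp [e]⟩
    exact hs.1.inBounds _ _ _ h1
  refine (((hs.1.logs d).1.of_isPrefix (List.take_prefix _ _)).sum_le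
    (fun c hc => hs.1.log_values d c (hsub c hc)) hitem
    (a := fun m => 1 + (m.size + matchSum (N.scope B n d m) fun m' => m'.size + 1))
    (b := fun m => 1 + (1 + matchSum (N.scope B n d m) fun _ => 1))
    (fun m φ => le_rfl) (fun m φ => le_rfl)).trans ?_
  unfold weight
  rw [← matchSum_mul, ← matchSum_mul, ← matchSum_add]
  refine matchSum_mono subset_rfl fun m _ => ?_
  have e1 : matchSum (N.scope B n d m) (fun m' => m'.size + 1) + (h + 2) *
      matchSum (N.scope B n d m) (fun _ => 1) ≤
      2 * matchSum (N.scope B n d m) (fun m' => m'.size + q) := by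
    rw [← matchSum_mul, ← matchSum_mul, ← matchSum_add]
    exact matchSum_mono subset_rfl fun m' _ => by omega
  have e2 : (h + 2) * (1 + (1 + matchSum (N.scope B n d m) fun _ => 1)) =
      2 * (h + 2) + (h + 2) * matchSum (N.scope B n d m) fun _ => 1 := by ring
  rw [e2]
  omega

/-- An upper bound for the charge of a node in terms of the weights of the bounding sets. -/
noncomputable def chargeBound (N : MarkingNet Q.toDirGraph ι) (B : ι → Set (PMap VQ EQ VH EH))
    (q : ℕ) (n : ι) : ℕ :=
  match N.kind n with
  | .vertexInput => weight q (B n)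
  | .union D => ∑ d ∈ D, 5 * weight q (B d)
  | .navigation d => 3 * weight q (B d) + 2 * weight q (B n)
  | .projection d => 5 * weight q (B d)
  | .assignment _ d => 5 * weight q (B d)
  | .filter _ d => 5 * weight q (B d)
  | .join l r => 3 * weight q (B l) + 3 * weight q (B r) + 4 * weight q (B n)

/-- Scopes come in two shapes. If a scope has at most one element, no larger than `m`, the factors 3
and 2 add up to 5 weights of the dependency. If it is a fibre of restriction, the results sum to the
weight of `B n`; a join has two dependencies and pays this twice. -/
theorem nodeCharge_le (hB : N.Bounds H Hp B (markingValues h))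
    (hs : N.Reachable H Hp B (markingValues h) s)
    (hq : h + 2 ≤ q) (n : ι) : N.nodeCharge B s n ≤ N.chargeBound B q n := by
  have single : (∀ d m, weight q (N.scope B n d m) ≤ m.size + q) →
      ∀ d, N.depCharge B s n d ≤ 5 * weight q (B d) := by
    intro hsc d
    refine (depCharge_le_scope hs hq n d).trans ?_
    have : (matchSum (B d) fun m => weight q (N.scope B n d m)) ≤ weight q (B d) :=
      matchSum_mono subset_rfl fun m _ => hsc d m
    omega
  have fiber : (∀ d m, N.scope B n d m = {m' | m' ∈ B n ∧ m'.restrict (N.query d) = m}) →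
      ∀ d, N.depCharge B s n d ≤ 3 * weight q (B d) + 2 * weight q (B n) := by
    intro hsc d
    refine (depCharge_le_scope hs hq n d).trans ?_
    have : (matchSum (B d) fun m => weight q (N.scope B n d m)) ≤ weight q (B n) := by
      simp only [hsc, weight]
      exact matchSum_fiber_le (B d) (B n) (fun m' => m'.restrict (N.query d)) fun m => m.size + q
    omega
  have hone : ∀ m : PMap VQ EQ VH EH, weight q {m} ≤ m.size + q := fun m =>
    (matchSum_singleton m _).le
  unfold nodeCharge chargeBound
  cases hk : N.kind n
  case vertexInput =>
    simp only [depList, hk, List.toFinset_nil, Finset.sum_empty, true_and, Nat.zero_add]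
    split_ifs
    · exact matchSum_mono subset_rfl fun m _ => by omega
    · exact Nat.zero_le _
  case union D =>
    simp only [depList, hk, reduceCtorEq, false_and, if_false, Nat.add_zero,
      Finset.toList_toFinset]
    exact Finset.sum_le_sum fun d _ => single (fun d m => by simpa [scope, hk] using hone m) d
  case navigation d =>
    simpa [depList, hk] using fiber (fun d m => by simp [scope, hk]) d
  case projection d =>
    simpa [depList, hk] using single (fun d m => by
      simpa [scope, hk] using (hone _).trans
        (Nat.add_le_add_right (m.size_restrict_le (N.query n)) q)) d
  case assignment x d =>
    simpa [depList, hk] using single (fun d m => by simpa [scope, hk] using hone m) d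
  case filter x d =>
    simpa [depList, hk] using single (fun d m => by simpa [scope, hk] using hone m) d
  case join l r =>
    have hn := (hB n).2
    rw [hk] at hn
    have h1 := fiber (fun d m => by simp [scope, hk]) l
    have h2 := fiber (fun d m => by simp [scope, hk]) r
    simp only [depList, hk, reduceCtorEq, false_and, if_false, Nat.add_zero, List.toFinset_cons,
      List.toFinset_nil, insert_empty_eq]
    rw [@Finset.sum_pair _ _ _ _ (Classical.decEq ι) _ _ hn.1]
    omega

end MarkingNet

/-! ### Matches of subgraphs -/

section Matches

variable {TV TE VQ EQ VH EH : Type*} {TG : DirGraph TV TE} {Q : TypedGraph TG VQ EQ}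
  {H : TypedGraph TG VH EH}

theorem allMatches.hasDomain {S : Subgraph Q.toDirGraph} {K : Subgraph H.toDirGraph}
    {m : PMap VQ EQ VH EH} (hm : m ∈ allMatches Q H S K) : m.HasDomain S := ⟨hm.1, hm.2.1⟩

theorem allMatches_subset_top (S : Subgraph Q.toDirGraph) (K : Subgraph H.toDirGraph) :
    allMatches Q H S K ⊆ allMatches Q H S ⊤ := fun _ ⟨h1, h2, h3, h4⟩ =>
  ⟨h1, h2, fun v x e => ⟨trivial, (h3 v x e).2⟩, fun e y he => ⟨trivial, (h4 e y he).2⟩⟩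

theorem restrict_ofVertex_mem_allMatches {S : Subgraph Q.toDirGraph} {v : VQ} (hv : v ∈ S.verts)
    {m : PMap VQ EQ VH EH} (hm : m ∈ allMatches Q H S ⊤) :
    m.restrict (Subgraph.ofVertex Q.toDirGraph v) ∈
      allMatches Q H (Subgraph.ofVertex Q.toDirGraph v) ⊤ := by
  obtain ⟨h1, h2, h3, h4⟩ := hm
  have hs := (h1 v).2 hv
  refine ⟨fun w => ?_, fun e => ?_, fun w x e => ?_, fun e y he => ?_⟩
  · by_cases hw : w = v <;> simp_all [PMap.restrict, Subgraph.ofVertex]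
  · simp [PMap.restrict, Subgraph.ofVertex]
  · by_cases hw : w = v
    · subst hw
      exact h3 w x (by simpa [PMap.restrict, Subgraph.ofVertex] using e)
    · simp [PMap.restrict, Subgraph.ofVertex, hw] at e
  · simp [PMap.restrict, Subgraph.ofVertex] at he

/-- Gluing of morphisms: each edge is taken from one side, where its ends are already mapped
correctly, and compatibility means that the other side cannot change them. -/
theorem union_mem_allMatches {A B : Subgraph Q.toDirGraph} {m m' : PMap VQ EQ VH EH}
    (hm : m ∈ allMatches Q H A ⊤) (hm' : m' ∈ allMatches Q H B ⊤)
    (hc : m.restrict (A ⊓ B) = m'.restrict (A ⊓ B)) :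
    m.union m' ∈ allMatches Q H (A ⊔ B) ⊤ := by
  have hcomm := PMap.union_comm (allMatches.hasDomain hm) (allMatches.hasDomain hm') hc
  have left : ∀ (m m' : PMap VQ EQ VH EH) v x, m.1 v = some x → (m.union m').1 v = some x := by
    intro m m' v x e
    simp [PMap.union, e]
  have right : ∀ v x, m'.1 v = some x → (m.union m').1 v = some x := by
    intro v x e
    rw [hcomm]
    exact left m' m v x e
  obtain ⟨h1, h2, h3, h4⟩ := hm
  obtain ⟨k1, k2, k3, k4⟩ := hm'
  refine ⟨fun v => ?_, fun e => ?_, fun v x e => ?_, fun e y he => ?_⟩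
  · change _ ↔ v ∈ A.verts ∪ B.verts
    rw [Set.mem_union, ← h1, ← k1]
    cases hv : m.1 v <;> simp [PMap.union, hv]
  · change _ ↔ e ∈ A.edges ∪ B.edges
    rw [Set.mem_union, ← h2, ← k2]
    cases hv : m.2 e <;> simp [PMap.union, hv]
  · cases hv : m.1 v with
    | some z =>
      have := left m m' v z hv
      rw [e] at this
      cases this
      exact h3 v x hv
    | none => exact k3 v x (by simpa [PMap.union, hv] using e)
  · cases hv : m.2 e with
    | some z =>
      have : z = y := by simpa [PMap.union, hv] using he
      subst this
      obtain ⟨a, b, c, d⟩ := h4 e z hv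
      exact ⟨a, b, left _ _ _ _ c, left _ _ _ _ d⟩
    | none =>
      obtain ⟨a, b, c, d⟩ := k4 e y (by simpa [PMap.union, hv] using he)
      exact ⟨a, b, right _ _ c, right _ _ d⟩

/-- Matches of a single vertex correspond to vertices of its type. -/
theorem ncard_allMatches_ofVertex_le [Finite VH] (v : VQ) :
    (allMatches Q H (Subgraph.ofVertex Q.toDirGraph v) ⊤).ncard ≤
      {x | H.vtype x = Q.vtype v}.ncard := by
  classical
  have : allMatches Q H (Subgraph.ofVertex Q.toDirGraph v) ⊤ ⊆
      (fun x => ((fun w => if w = v then some x else none, fun _ => none) : PMap VQ EQ VH EH)) ''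
        {x | H.vtype x = Q.vtype v} := by
    rintro m ⟨h1, h2, h3, h4⟩
    obtain ⟨x, hx⟩ := Option.isSome_iff_exists.1 ((h1 v).2 rfl)
    refine ⟨x, (h3 v x hx).2, Prod.ext (funext fun w => ?_) (funext fun e => ?_)⟩
    · by_cases hw : w = v
      · subst hw; simp [hx]
      · have := (h1 w).not.2 hw
        simpa [hw] using (Option.not_isSome_iff_eq_none.1 this).symm
    · have := (h2 e).not.2 (fun h => h.elim)
      exact (Option.not_isSome_iff_eq_none.1 this).symm
  exact (Set.ncard_le_ncard this ((Set.toFinite _).image _)).trans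
    (Set.ncard_image_le (Set.toFinite _))

/-- Every edge of the right type yields a match of a query edge that is not a loop. -/
theorem ncard_edges_le_ncard_allMatches [Finite VQ] [Finite EQ] [Finite VH] [Finite EH] (e : EQ)
    (he : Q.src e ≠ Q.tgt e) :
    {y | H.etype y = Q.etype e}.ncard ≤
      (allMatches Q H (Subgraph.ofEdge Q.toDirGraph e) ⊤).ncard := by
  classical
  -- The target vertex reaches the second branch only because the query edge is not a loop; a loop
  -- could be matched by host loops only.
  let f : EH → PMap VQ EQ VH EH := fun y =>
    (fun w => if w = Q.src e then some (H.src y) else if w = Q.tgt e then some (H.tgt y) else none,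
      fun e' => if e' = e then some y else none)
  refine Set.ncard_le_ncard_of_injOn f ?_ ?_ (Set.toFinite _)
  · intro y hy
    have hy : H.etype y = Q.etype e := hy
    refine ⟨fun v => ?_, fun e' => ?_, fun v x hx => ?_, fun e' y' hy' => ?_⟩
    · by_cases h1 : v = Q.src e <;> by_cases h2 : v = Q.tgt e <;>
        simp [f, Subgraph.ofEdge, h1, h2, he.symm]
    · by_cases h1 : e' = e <;> simp [f, Subgraph.ofEdge, h1]
    · refine ⟨trivial, ?_⟩
      by_cases h1 : v = Q.src e
      · subst h1
        simp only [f, if_true, Option.some.injEq] at hx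
        rw [← hx, H.src_type, Q.src_type, hy]
      · by_cases h2 : v = Q.tgt e
        · subst h2
          simp only [f, if_neg he.symm, if_true, Option.some.injEq] at hx
          rw [← hx, H.tgt_type, Q.tgt_type, hy]
        · simp [f, h1, h2] at hx
    · by_cases h1 : e' = e
      · subst h1
        simp only [f, if_true, Option.some.injEq] at hy'
        subst hy'
        exact ⟨trivial, hy, by simp [f], by simp [f, he.symm]⟩
      · simp [f, h1] at hy'
  · intro y _ y' _ h
    simpa [f] using congrFun (congrArg Prod.snd h) e

/-- The use of edge domination: vertex matches number at most the vertices of that type, hence at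
most the edges of the adjacent edge type, and each such edge is a match. -/
theorem ncard_vertexMatches_le [Finite VQ] [Finite EQ] [Finite VH] [Finite EH]
    (hH : H.EdgeDominated) (e : EQ) (he : Q.src e ≠ Q.tgt e) (x : EdgeEnd) :
    (allMatches Q H (Subgraph.ofVertex Q.toDirGraph (Q.endpoint x e)) ⊤).ncard ≤
      (allMatches Q H (Subgraph.ofEdge Q.toDirGraph e) ⊤).ncard := by
  refine (ncard_allMatches_ofVertex_le _).trans (le_trans ?_ (ncard_edges_le_ncard_allMatches e he))
  have := max_le_iff.1 (hH (Q.etype e))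
  cases x with
  | source => simpa [DirGraph.endpoint, Q.src_type] using this.1
  | target => simpa [DirGraph.endpoint, Q.tgt_type] using this.2

end Matches

/-! ### Join trees -/

namespace JoinTree

variable {V E : Type*}

theorem subtree_append {t t' : JoinTree E} {p : List Bool} (h : t.subtree p = some t')
    (q : List Bool) : t.subtree (p ++ q) = t'.subtree q := by
  induction p generalizing t with
  | nil =>
    simp only [subtree, Option.some.injEq] at h
    rw [h, List.nil_append]
  | cons b p ih =>
    cases t with
    | input e => simp [subtree] at h
    | join l r => cases b <;> exact ih h

theorem subtree_child {t l r : JoinTree E} {p : List Bool} (h : t.subtree p = some (join l r))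
    (b : Bool) : t.subtree (p ++ [b]) = some (if b then r else l) := by
  rw [subtree_append h]
  cases b <;> simp [subtree]

theorem mem_nodes_iff {t : JoinTree E} {p : List Bool} :
    p ∈ t.nodes ↔ ∃ t', t.subtree p = some t' := by
  induction t generalizing p with
  | input e => cases p <;> simp [nodes, subtree]
  | join l r ihl ihr =>
    rcases p with _ | ⟨b, p⟩
    · simp [nodes, subtree]
    · cases b <;> simp [nodes, subtree, ihl, ihr]

theorem height_subtree_le {t t' : JoinTree E} {p : List Bool} (h : t.subtree p = some t') :
    t'.height ≤ t.height := by
  induction p generalizing t with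
  | nil =>
    simp only [subtree, Option.some.injEq] at h
    rw [h]
  | cons b p ih =>
    cases t with
    | input e => simp [subtree] at h
    | join l r =>
      have hh : (join l r).height = max l.height r.height + 1 := rfl
      cases b
      · have := ih (t := l) h
        omega
      · have := ih (t := r) h
        omega

/-- A leaf has two vertices and one edge, hence the 3. Both children of a join are proper subgraphs,
so each level adds at least one vertex or edge. -/
theorem height_add_three_le [Finite V] [Finite E] {G : DirGraph V E} (hG : ∀ e, G.src e ≠ G.tgt e)
    {t : JoinTree E} (ht : t.WellFormed G) :
    t.height + 3 ≤ (t.query G).verts.ncard + (t.query G).edges.ncard := by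
  have lt : ∀ {A B : Subgraph G}, A.verts ⊆ B.verts → A.edges ⊆ B.edges → A ≠ B →
      A.verts.ncard + A.edges.ncard < B.verts.ncard + B.edges.ncard := by
    rintro ⟨v, e, a, b⟩ ⟨v', e', a', b'⟩ hv he hne
    have h1 := Set.ncard_le_ncard hv (Set.toFinite _)
    have h2 := Set.ncard_le_ncard he (Set.toFinite _)
    dsimp only at hv he h1 h2 ⊢
    by_contra hcon
    have e1 := Set.eq_of_subset_of_ncard_le hv (by omega) (Set.toFinite _)
    have e2 := Set.eq_of_subset_of_ncard_le he (by omega) (Set.toFinite _)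
    subst e1 e2
    exact hne rfl
  induction t with
  | input e => simp [height, query, Subgraph.ofEdge, Set.ncard_pair (hG e)]
  | join l r ihl ihr =>
    obtain ⟨hl, hr, -, h1, h2⟩ := ht
    have a := lt (A := l.query G) (B := l.query G ⊔ r.query G) Set.subset_union_left
      Set.subset_union_left h1
    have b := lt (A := r.query G) (B := l.query G ⊔ r.query G) Set.subset_union_right
      Set.subset_union_right h2
    have := ihl hl
    have := ihr hr
    change max l.height r.height + 1 + 3 ≤
      (l.query G ⊔ r.query G).verts.ncard + (l.query G ⊔ r.query G).edges.ncard
    omega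

section Consistent

variable {TV TE VH EH : Type*} {TG : DirGraph TV TE} {Q : TypedGraph TG V E}
  {H : TypedGraph TG VH EH} {t : JoinTree E} {C : List Bool → Set (PMap V E VH EH)}

theorem Consistent.input (hC : t.Consistent Q H C) {p : List Bool} {e : E}
    (hp : t.subtree p = some (input e)) :
    C p = allMatches Q H (Subgraph.ofEdge Q.toDirGraph e) ⊤ := by
  rw [hC p (mem_nodes_iff.2 ⟨_, hp⟩), results, hp]

theorem Consistent.union_mem (hC : t.Consistent Q H C) {p : List Bool} {l r : JoinTree E}
    (hp : t.subtree p = some (join l r)) {ml mr : PMap V E VH EH} (hl : ml ∈ C (p ++ [false]))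
    (hr : mr ∈ C (p ++ [true]))
    (hc : ml.restrict (l.query Q.toDirGraph ⊓ r.query Q.toDirGraph) =
      mr.restrict (l.query Q.toDirGraph ⊓ r.query Q.toDirGraph)) : ml.union mr ∈ C p := by
  rw [hC p (mem_nodes_iff.2 ⟨_, hp⟩), results, hp]
  exact ⟨ml, hl, mr, hr, hc, rfl⟩

theorem Consistent.subset_allMatches (hC : t.Consistent Q H C) {t' : JoinTree E} {p : List Bool}
    (hp : t.subtree p = some t') : C p ⊆ allMatches Q H (t'.query Q.toDirGraph) ⊤ := by
  induction t' generalizing p with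
  | input e => rw [hC.input hp]; exact subset_rfl
  | join l r ihl ihr =>
    rw [hC p (mem_nodes_iff.2 ⟨_, hp⟩), results, hp]
    rintro m ⟨ml, hl, mr, hr, hc, rfl⟩
    exact union_mem_allMatches (ihl (by simpa using subtree_child hp false) hl)
      (ihr (by simpa using subtree_child hp true) hr) hc

end Consistent

end JoinTree

/-! ### Bounding sets for the results of the localized net -/

namespace JoinTree

variable {TV TE V E VH EH : Type*} {TG : DirGraph TV TE}

/-- Sets of matches that contain the results of the nodes of the localized net: those of the
original net for the nodes that correspond to it, and their restrictions for the request projection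
structures. -/
def localBound (t : JoinTree E) (Q : TypedGraph TG V E) (H : TypedGraph TG VH EH)
    (C : List Bool → Set (PMap V E VH EH)) (req : List Bool → Bool → Request V) (n : LocalNode) :
    Set (PMap V E VH EH) :=
  match t.subtree n.1, n.2 with
  | some (input e), .vertexInput x =>
      allMatches Q H (Subgraph.ofVertex Q.toDirGraph (Q.endpoint x e)) ⊤
  | some (input e), .extension x =>
      allMatches Q H (Subgraph.ofVertex Q.toDirGraph (Q.endpoint x e)) ⊤
  | some (input _), .navigation _ => C n.1
  | some (input _), .union => C n.1
  | some (join _ _), .join => C n.1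
  | some (join _ _), .filter b => C (n.1 ++ [b])
  | some (join _ _), .projection b =>
      (fun m => m.restrict (Subgraph.ofVertex Q.toDirGraph (req n.1 b).vertex)) '' C (n.1 ++ [b])
  | some (join _ _), .assignment b =>
      (fun m => m.restrict (Subgraph.ofVertex Q.toDirGraph (req n.1 b).vertex)) '' C (n.1 ++ [b])
  | _, _ => ∅

variable {t : JoinTree E} {Q : TypedGraph TG V E} {H : TypedGraph TG VH EH}
  {Hp : Subgraph H.toDirGraph} {C : List Bool → Set (PMap V E VH EH)}
  {req : List Bool → Bool → Request V}

theorem localRoot_fst (p : List Bool) : (t.localRoot p).1 = p := by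
  unfold localRoot
  split <;> rfl

theorem localBound_localRoot {t' : JoinTree E} {p : List Bool} (hp : t.subtree p = some t') :
    t.localBound Q H C req (t.localRoot p) = C p := by
  cases t' <;> simp [localBound, localRoot, hp]

theorem query_localRoot {t' : JoinTree E} {p : List Bool} (hp : t.subtree p = some t') :
    (t.localize Q.toDirGraph req).query (t.localRoot p) = t'.query Q.toDirGraph := by
  cases t' <;> simp [localize, localRoot, hp, query]

theorem mem_requestsAt {p : List Bool} {x : EdgeEnd} {d : LocalNode} :
    d ∈ t.requestsAt req p x ↔ ∃ q b, d = (q, .assignment b) ∧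
      (∃ l r, t.subtree q = some (join l r)) ∧ q ++ (!b) :: (req q b).leaf = p ∧
      (req q b).ending = x := by
  simp only [requestsAt, Finset.mem_image, Finset.mem_filter, Finset.mem_product, Finset.mem_univ,
    and_true, Prod.exists]
  constructor
  · rintro ⟨q, b, ⟨-, h⟩, rfl⟩
    exact ⟨q, b, rfl, h⟩
  · rintro ⟨q, b, rfl, ⟨l, r, h⟩, h'⟩
    exact ⟨q, b, ⟨mem_nodes_iff.2 ⟨_, h⟩, ⟨l, r, h⟩, h'⟩, rfl⟩

/-- The results of a request projection structure are matches of the vertex at the extension point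
to which it is connected. -/
theorem localBound_request_subset (hC : t.Consistent Q H C)
    (hreq : t.ValidRequests Q.toDirGraph req) {p : List Bool} {e : E}
    (hp : t.subtree p = some (input e)) {x : EdgeEnd} {d : LocalNode}
    (hd : d ∈ t.requestsAt req p x) :
    t.localBound Q H C req d ⊆
      allMatches Q H (Subgraph.ofVertex Q.toDirGraph (Q.endpoint x e)) ⊤ := by
  obtain ⟨q, b, rfl, ⟨l, r, hq⟩, rfl, rfl⟩ := mem_requestsAt.1 hd
  obtain ⟨hv, e', he', hend⟩ := hreq q l r hq b
  have h1 : t.subtree (q ++ (!b) :: (req q b).leaf) = some (input e') := by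
    have := subtree_append (subtree_child hq (!b)) (req q b).leaf
    rw [List.append_assoc, List.singleton_append] at this
    rw [this]
    cases b <;> simpa using he'
  rw [h1] at hp
  simp only [Option.some.injEq, input.injEq] at hp
  subst hp
  simp only [localBound, hq]
  rintro _ ⟨m, hm, rfl⟩
  have hm' := hC.subset_allMatches (subtree_child hq b) hm
  rw [← hend] at hv ⊢
  refine restrict_ofVertex_mem_allMatches ?_ hm'
  cases b
  · exact hv.1
  · exact hv.2

/-- Localization only ever restricts the matches considered, so the consistent configuration of the
original net bounds every node regardless of execution order. Markings originate as `∞` at vertex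
inputs or as heights of subtrees at assignments, and the other nodes only copy them or take maxima.
-/
theorem localize_bounds (hC : t.Consistent Q H C) (hreq : t.ValidRequests Q.toDirGraph req) :
    (t.localize Q.toDirGraph req).Bounds H Hp (t.localBound Q H C req)
      (markingValues t.height) := by
  rintro ⟨p, role⟩
  -- The root of a child has a longer address, so a node of the join `p` cannot be its own
  -- dependency.
  have hne : ∀ b ρ, (p, ρ) ≠ t.localRoot (p ++ [b]) := fun b ρ h => by
    have := congrArg Prod.fst h
    rw [localRoot_fst] at this
    simp at this
  rcases hp : t.subtree p with _ | _ | ⟨l, r⟩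
  · cases role <;> simp [MarkingNet.depList, localize, hp]
  · rename_i e
    cases role with
    | vertexInput x =>
      refine ⟨by simp [MarkingNet.depList, localize, hp], ?_⟩
      simp only [localize, hp, localBound]
      exact ⟨allMatches_subset_top _ _, Or.inl rfl⟩
    | extension x =>
      refine ⟨?_, ?_⟩
      · simp only [MarkingNet.depList, localize, hp, Finset.mem_toList, Finset.mem_insert]
        rintro (h | h)
        · simp at h
        · obtain ⟨q, b, h, -⟩ := mem_requestsAt.1 h
          simp at h
      · simp only [localize, hp]
        intro d hd
        rcases Finset.mem_insert.1 hd with rfl | hd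
        · simp [localBound, hp]
        · refine (localBound_request_subset hC hreq hp hd).trans ?_
          simp [localBound, hp]
    | navigation x =>
      refine ⟨by simp [MarkingNet.depList, localize, hp], ?_⟩
      simp only [localize, hp, localBound]
      rw [hC.input hp]
    | union =>
      refine ⟨by simp [MarkingNet.depList, localize, hp], ?_⟩
      simp [localize, hp, localBound]
    | _ => simp [MarkingNet.depList, localize, hp]
  · have hheight := height_subtree_le hp
    cases role with
    | join =>
      have h0 := subtree_child hp false
      have h1 := subtree_child hp true
      simp only [Bool.false_eq_true, if_false, if_true] at h0 h1
      refine ⟨?_, ?_⟩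
      · simp only [MarkingNet.depList, localize, hp, List.mem_cons, hne, List.not_mem_nil, or_self,
          not_false_eq_true]
      · have hk : (t.localize Q.toDirGraph req).kind (p, .join) =
            .join (t.localRoot (p ++ [false])) (t.localRoot (p ++ [true])) := by
          simp [localize, hp]
        rw [hk]
        dsimp only
        rw [query_localRoot h0, query_localRoot h1, localBound_localRoot h0,
          localBound_localRoot h1]
        refine ⟨fun h => ?_, fun m hm => allMatches.hasDomain (hC.subset_allMatches h0 hm),
          fun m hm => allMatches.hasDomain (hC.subset_allMatches h1 hm), fun ml hl mr hr hc => ?_⟩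
        · have := congrArg Prod.fst h
          rw [localRoot_fst, localRoot_fst] at this
          simp at this
        · have := hC.union_mem hp hl hr hc
          simpa [localBound, hp] using this
    | filter b =>
      refine ⟨by simp only [MarkingNet.depList, localize, hp, List.mem_cons, hne, List.not_mem_nil,
        or_self, not_false_eq_true], ?_⟩
      simp only [localize, hp]
      rw [localBound_localRoot (subtree_child hp b)]
      simp [localBound, hp]
    | projection b =>
      refine ⟨by simp [MarkingNet.depList, localize, hp], ?_⟩
      simp only [localize, hp, localBound]
      exact fun m hm => ⟨m, hm, rfl⟩
    | assignment b =>
      refine ⟨by simp [MarkingNet.depList, localize, hp], ?_⟩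
      simp only [localize, hp, localBound]
      exact ⟨subset_rfl, Or.inr (by exact_mod_cast hheight)⟩
    | _ => simp [MarkingNet.depList, localize, hp]

theorem mem_nodes_of_mem_order {sort : List Bool → List LocalNode}
    (hsort : ∀ p e, t.subtree p = some (input e) →
      (t.localize Q.toDirGraph req).IsReverseToposort (navigationStructure p) (sort p))
    {t' : JoinTree E} {p : List Bool} (hp : t.subtree p = some t') {n : LocalNode}
    (hn : n ∈ t'.order sort p) : n ∈ (t.localize Q.toDirGraph req).nodes := by
  induction t' generalizing p with
  | input e =>
    have := ((hsort p e hp).2.1 n).1 hn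
    simp only [localize, Finset.mem_biUnion]
    refine ⟨p, mem_nodes_iff.2 ⟨_, hp⟩, ?_⟩
    rw [hp]
    exact this
  | join l r ihl ihr =>
    have h0 := subtree_child hp false
    have h1 := subtree_child hp true
    simp only [Bool.false_eq_true, if_false, if_true] at h0 h1
    have own : n ∈ joinStructure p → n ∈ (t.localize Q.toDirGraph req).nodes := by
      intro h
      simp only [localize, Finset.mem_biUnion]
      refine ⟨p, mem_nodes_iff.2 ⟨_, hp⟩, ?_⟩
      rw [hp]
      exact h
    simp only [order, requestOrder, List.mem_append, List.mem_cons, List.not_mem_nil,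
      or_false] at hn
    rcases hn with (((((h | h) | h) | h) | h) | h) | h
    · exact own (by rcases h with h | h | h <;> simp [joinStructure, h])
    · exact ihl h0 h
    · exact own (by rcases h with h | h | h <;> simp [joinStructure, h])
    · exact ihr h1 h
    · exact own (by rcases h with h | h | h <;> simp [joinStructure, h])
    · exact ihl h0 h
    · exact own (by simp [joinStructure, h])

end JoinTree

/-! ### The total charge of the localized net -/

section Weight

variable {VQ EQ VH EH : Type*} [Finite VQ] [Finite EQ] [Finite VH] [Finite EH]

theorem matchSum_const {α : Type*} [Finite α] (S : Set α) (k : ℕ) :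
    matchSum S (fun _ => k) = S.ncard * k := by
  rw [matchSum, Finset.sum_const, smul_eq_mul, Set.ncard_eq_toFinset_card S S.toFinite]

theorem matchSum_image_le {α β : Type*} [Finite α] [Finite β] (r : α → β) (S : Set α)
    (f : β → ℕ) : matchSum (r '' S) f ≤ matchSum S fun m => f (r m) := by
  refine le_trans (matchSum_mono subset_rfl ?_)
    (matchSum_fiber_le (r '' S) S r fun m => f (r m))
  rintro _ ⟨m, hm, rfl⟩
  -- Every point of the image has at least one preimage, so its fibre already contributes its value.
  exact Finset.single_le_sum (f := fun m => f (r m)) (fun _ _ => Nat.zero_le _)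
    (by simpa using hm)

theorem weight_image_restrict_le {G : DirGraph VQ EQ} (q : ℕ) (S : Subgraph G)
    (A : Set (PMap VQ EQ VH EH)) :
    weight q ((fun m => m.restrict S) '' A) ≤ weight q A :=
  (matchSum_image_le _ A _).trans
    (matchSum_mono subset_rfl fun m _ => Nat.add_le_add_right (m.size_restrict_le S) q)

theorem weight_eq (q : ℕ) (A : Set (PMap VQ EQ VH EH)) :
    weight q A = (∑ᶠ m ∈ A, m.size) + A.ncard * q := by
  rw [weight, matchSum_add, matchSum_const, finsum_mem_eq_finite_toFinset_sum _ A.toFinite]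
  rfl

/-- Vertex matches weigh exactly `1 + q` each; edge matches weigh at least that much and are at
least as numerous. -/
theorem weight_vertexMatches_le {TV TE : Type*} {TG : DirGraph TV TE} {Q : TypedGraph TG VQ EQ}
    {H : TypedGraph TG VH EH} (hH : H.EdgeDominated) (q : ℕ) (e : EQ) (he : Q.src e ≠ Q.tgt e)
    (x : EdgeEnd) :
    weight q (allMatches Q H (Subgraph.ofVertex Q.toDirGraph (Q.endpoint x e)) ⊤) ≤
      weight q (allMatches Q H (Subgraph.ofEdge Q.toDirGraph e) ⊤) := by
  calc weight q (allMatches Q H (Subgraph.ofVertex Q.toDirGraph (Q.endpoint x e)) ⊤)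
      ≤ matchSum (allMatches Q H (Subgraph.ofVertex Q.toDirGraph (Q.endpoint x e)) ⊤)
          fun _ => 1 + q := matchSum_mono subset_rfl fun m hm => by
            rw [(allMatches.hasDomain hm).size_eq]
            simp [Subgraph.ofVertex]
    _ ≤ matchSum (allMatches Q H (Subgraph.ofEdge Q.toDirGraph e) ⊤) fun _ => 1 + q := by
        rw [matchSum_const, matchSum_const]
        exact Nat.mul_le_mul_right _ (ncard_vertexMatches_le hH e he x)
    _ ≤ _ := matchSum_mono subset_rfl fun m hm => by
        rw [(allMatches.hasDomain hm).size_eq]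
        simp [Subgraph.ofEdge]

end Weight

namespace JoinTree

variable {TV TE V E VH EH : Type*} {TG : DirGraph TV TE} {t : JoinTree E}

/-- The first component of a local node is the original node it belongs to, so the local structures
are disjoint. -/
theorem sum_localize_nodes {G : DirGraph V E} {req : List Bool → Bool → Request V}
    (f : LocalNode → ℕ) :
    ∑ n ∈ (t.localize G req).nodes, f n = ∑ p ∈ t.nodes, ∑ n ∈
      (match t.subtree p with
        | some (input _) => navigationStructure p
        | some (join _ _) => joinStructure p
        | none => ∅), f n := by
  refine Finset.sum_biUnion fun p _ q _ hpq => ?_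
  have key : ∀ p : List Bool, ∀ n ∈ (match t.subtree p with
        | some (input _) => navigationStructure p
        | some (join _ _) => joinStructure p
        | none => ∅), n.1 = p := by
    intro p n hn
    split at hn
    · simp only [navigationStructure, Finset.mem_insert, Finset.mem_singleton] at hn
      rcases hn with h | h | h | h | h | h | h <;> rw [h]
    · simp only [joinStructure, Finset.mem_insert, Finset.mem_singleton] at hn
      rcases hn with h | h | h | h | h | h | h <;> rw [h]
    · simp at hn
  exact Finset.disjoint_left.2 fun n h1 h2 => hpq ((key p n h1).symm.trans (key q n h2))

theorem sum_navigationStructure (f : LocalNode → ℕ) (p : List Bool) :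
    ∑ n ∈ navigationStructure p, f n = f (p, .vertexInput .source) + (f (p, .vertexInput .target) +
      (f (p, .extension .source) + (f (p, .extension .target) + (f (p, .navigation .source) +
      (f (p, .navigation .target) + f (p, .union)))))) := by
  unfold navigationStructure
  repeat rw [Finset.sum_insert (by simp)]
  rw [Finset.sum_singleton]

theorem sum_joinStructure (f : LocalNode → ℕ) (p : List Bool) :
    ∑ n ∈ joinStructure p, f n = f (p, .join) + (f (p, .filter false) + (f (p, .projection false) +
      (f (p, .assignment false) + (f (p, .filter true) + (f (p, .projection true) +
      f (p, .assignment true)))))) := by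
  unfold joinStructure
  repeat rw [Finset.sum_insert (by simp)]
  rw [Finset.sum_singleton]

open Classical in
/-- The pairs of a join and one of its two dependencies. -/
noncomputable def joinChildren (t : JoinTree E) : Finset (List Bool × Bool) :=
  (t.nodes ×ˢ (Finset.univ : Finset Bool)).filter fun a => ∃ l r, t.subtree a.1 = some (join l r)

theorem mem_joinChildren {a : List Bool × Bool} :
    a ∈ t.joinChildren ↔ ∃ l r, t.subtree a.1 = some (join l r) := by
  simp only [joinChildren, Finset.mem_filter, Finset.mem_product, Finset.mem_univ, and_true,
    and_iff_right_iff_imp]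
  rintro ⟨l, r, h⟩
  exact mem_nodes_iff.2 ⟨_, h⟩

/-- Every node is a dependency of at most one join. -/
theorem sum_joinChildren_le (f : List Bool → ℕ) :
    ∑ a ∈ t.joinChildren, f (a.1 ++ [a.2]) ≤ ∑ p ∈ t.nodes, f p := by
  classical
  rw [← Finset.sum_image (f := f) (g := fun a : List Bool × Bool => a.1 ++ [a.2])]
  · refine Finset.sum_le_sum_of_subset fun p hp => ?_
    obtain ⟨a, ha, rfl⟩ := Finset.mem_image.1 hp
    obtain ⟨l, r, h⟩ := mem_joinChildren.1 ha
    exact mem_nodes_iff.2 ⟨_, subtree_child h a.2⟩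
  · rintro ⟨p, b⟩ _ ⟨p', b'⟩ _ h
    obtain ⟨h1, h2⟩ := List.append_inj' h rfl
    simp only [List.cons.injEq, and_true] at h1 h2
    rw [h1, h2]

theorem sum_nodes_join_le (f : List Bool → ℕ) :
    ∑ p ∈ t.nodes, (match t.subtree p with
      | some (join _ _) => f (p ++ [false]) + f (p ++ [true])
      | _ => 0) ≤ ∑ p ∈ t.nodes, f p := by
  classical
  refine le_trans (le_of_eq ?_) (sum_joinChildren_le f)
  rw [joinChildren, Finset.sum_filter, Finset.sum_product]
  refine Finset.sum_congr rfl fun p _ => ?_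
  rcases hp : t.subtree p with _ | _ | _ <;> simp [hp, add_comm]

/-- Every request projection structure is connected to one extension point. -/
theorem sum_requestsAt_le (req : List Bool → Bool → Request V) (f : LocalNode → ℕ) :
    ∑ p ∈ t.nodes, (∑ d ∈ t.requestsAt req p .source, f d + ∑ d ∈ t.requestsAt req p .target, f d) ≤
      ∑ a ∈ t.joinChildren, f (a.1, .assignment a.2) := by
  classical
  have h1 : ∀ p x, ∑ d ∈ t.requestsAt req p x, f d =
      ∑ a ∈ t.joinChildren with
        (a.1 ++ (!a.2) :: (req a.1 a.2).leaf, (req a.1 a.2).ending) = (p, x),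
        f (a.1, .assignment a.2) := by
    intro p x
    have e : t.requestsAt req p x = (t.joinChildren.filter fun a =>
        (a.1 ++ (!a.2) :: (req a.1 a.2).leaf, (req a.1 a.2).ending) = (p, x)).image
          fun a => (a.1, Role.assignment a.2) := by
      ext d
      simp only [mem_requestsAt, Finset.mem_image, Finset.mem_filter, mem_joinChildren,
        Prod.mk.injEq, Prod.exists]
      exact exists₂_congr fun q b => ⟨fun ⟨h, h'⟩ => ⟨h', h.symm⟩, fun ⟨h, h'⟩ => ⟨h'.symm, h⟩⟩
    rw [e, Finset.sum_image]
    rintro ⟨q, b⟩ _ ⟨q', b'⟩ _ h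
    simpa using h
  have h2 : ∀ p, ∑ d ∈ t.requestsAt req p .source, f d + ∑ d ∈ t.requestsAt req p .target, f d =
      ∑ x ∈ ({.source, .target} : Finset EdgeEnd), ∑ d ∈ t.requestsAt req p x, f d := by
    intro p
    rw [Finset.sum_pair (by simp)]
  rw [Finset.sum_congr rfl fun p _ => h2 p]
  simp only [h1]
  -- The requests are grouped by the pair of leaf and edge end to which they are attached; this is a
  -- function of the request, so each is counted at most once.
  rw [← Finset.sum_product' t.nodes ({.source, .target} : Finset EdgeEnd)
    (fun p x => ∑ a ∈ t.joinChildren with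
        (a.1 ++ (!a.2) :: (req a.1 a.2).leaf, (req a.1 a.2).ending) = (p, x),
        f (a.1, .assignment a.2))]
  refine (Finset.sum_fiberwise_eq_sum_filter t.joinChildren
    (t.nodes ×ˢ ({.source, .target} : Finset EdgeEnd))
    (fun a => (a.1 ++ (!a.2) :: (req a.1 a.2).leaf, (req a.1 a.2).ending))
    fun a => f (a.1, .assignment a.2)).le.trans ?_
  exact Finset.sum_le_sum_of_subset (Finset.filter_subset _ _)

variable [Finite V] [Finite E] [Finite VH] [Finite EH]
  {Q : TypedGraph TG V E} {H : TypedGraph TG VH EH} {C : List Bool → Set (PMap V E VH EH)}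
  {req : List Bool → Bool → Request V}

theorem weight_localBound_assignment_le {p : List Bool} (q : ℕ) {l r : JoinTree E}
    (hp : t.subtree p = some (join l r)) (b : Bool) :
    weight q (t.localBound Q H C req (p, .assignment b)) ≤ weight q (C (p ++ [b])) := by
  simp only [localBound, hp]
  exact weight_image_restrict_le q _ _

/-- The 32 is `2·1` for the vertex inputs, `2·5` for the extension points' own inputs, `2·5` for the
navigation nodes and 10 for the union. The requests are kept apart, since they originate from other
nodes. -/
theorem sum_chargeBound_navigationStructure_le (hQ : ∀ e, Q.src e ≠ Q.tgt e)
    (hH : H.EdgeDominated) (hC : t.Consistent Q H C) (q : ℕ) {p : List Bool} {e : E}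
    (hp : t.subtree p = some (input e)) :
    ∑ n ∈ navigationStructure p,
        (t.localize Q.toDirGraph req).chargeBound (t.localBound Q H C req) q n ≤
      32 * weight q (C p) + 5 *
        (∑ d ∈ t.requestsAt req p .source, weight q (t.localBound Q H C req d) +
          ∑ d ∈ t.requestsAt req p .target, weight q (t.localBound Q H C req d)) := by
  have hv : ∀ x, weight q (allMatches Q H (Subgraph.ofVertex Q.toDirGraph (Q.endpoint x e)) ⊤) ≤
      weight q (C p) := fun x => by
    rw [hC.input hp]
    exact weight_vertexMatches_le hH q e (hQ e) x
  have vi : ∀ x, (t.localize Q.toDirGraph req).chargeBound (t.localBound Q H C req) q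
      (p, .vertexInput x) ≤ weight q (C p) := fun x => by
    simpa [MarkingNet.chargeBound, localize, hp, localBound] using hv x
  have ext : ∀ x, (t.localize Q.toDirGraph req).chargeBound (t.localBound Q H C req) q
      (p, .extension x) ≤ 5 * weight q (C p) +
        5 * ∑ d ∈ t.requestsAt req p x, weight q (t.localBound Q H C req d) := fun x => by
    have hmem : (p, Role.vertexInput x) ∉ t.requestsAt req p x := fun h => by
      obtain ⟨q', b, h, -⟩ := mem_requestsAt.1 h
      simp at h
    simp only [MarkingNet.chargeBound, localize, hp]
    rw [Finset.sum_insert hmem, ← Finset.mul_sum]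
    have e0 : t.localBound Q H C req (p, .vertexInput x) =
        allMatches Q H (Subgraph.ofVertex Q.toDirGraph (Q.endpoint x e)) ⊤ := by
      simp [localBound, hp]
    rw [e0]
    exact Nat.add_le_add (Nat.mul_le_mul_left 5 (hv x)) le_rfl
  have nav : ∀ x, (t.localize Q.toDirGraph req).chargeBound (t.localBound Q H C req) q
      (p, .navigation x) ≤ 5 * weight q (C p) := fun x => by
    have := hv x
    simp only [MarkingNet.chargeBound, localize, hp, localBound]
    omega
  have un : (t.localize Q.toDirGraph req).chargeBound (t.localBound Q H C req) q
      (p, .union) = 10 * weight q (C p) := by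
    simp only [MarkingNet.chargeBound, localize, hp]
    rw [Finset.sum_pair (by simp)]
    simp only [localBound, hp]
    omega
  rw [sum_navigationStructure, un]
  have := vi .source
  have := vi .target
  have := ext .source
  have := ext .target
  have := nav .source
  have := nav .target
  omega

/-- Each child contributes 3 through the join and 5 for each of the three nodes of its request
structure, hence 18. -/
theorem sum_chargeBound_joinStructure_le (q : ℕ) {p : List Bool} {l r : JoinTree E}
    (hp : t.subtree p = some (join l r)) :
    ∑ n ∈ joinStructure p,
        (t.localize Q.toDirGraph req).chargeBound (t.localBound Q H C req) q n ≤
      4 * weight q (C p) + 18 * (weight q (C (p ++ [false])) + weight q (C (p ++ [true]))) := by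
  have jn : (t.localize Q.toDirGraph req).chargeBound (t.localBound Q H C req) q (p, .join) =
      3 * weight q (C (p ++ [false])) + 3 * weight q (C (p ++ [true])) + 4 * weight q (C p) := by
    have h1 := localBound_localRoot (Q := Q) (H := H) (C := C) (req := req) (subtree_child hp false)
    have h2 := localBound_localRoot (Q := Q) (H := H) (C := C) (req := req) (subtree_child hp true)
    simp only [MarkingNet.chargeBound, localize, hp, h1, h2]
    simp only [localBound, hp]
  have fi : ∀ b, (t.localize Q.toDirGraph req).chargeBound (t.localBound Q H C req) q
      (p, .filter b) = 5 * weight q (C (p ++ [b])) := fun b => by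
    simp only [MarkingNet.chargeBound, localize, hp, localBound_localRoot (subtree_child hp b)]
  have pr : ∀ b, (t.localize Q.toDirGraph req).chargeBound (t.localBound Q H C req) q
      (p, .projection b) = 5 * weight q (C (p ++ [b])) := fun b => by
    simp only [MarkingNet.chargeBound, localize, hp, localBound]
  have as : ∀ b, (t.localize Q.toDirGraph req).chargeBound (t.localBound Q H C req) q
      (p, .assignment b) ≤ 5 * weight q (C (p ++ [b])) := fun b => by
    have := weight_localBound_assignment_le (Q := Q) (H := H) (C := C) (req := req) q hp b
    simp only [MarkingNet.chargeBound, localize, hp, localBound] at this ⊢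
    omega
  rw [sum_joinStructure, jn, fi, fi, pr, pr]
  have := as false
  have := as true
  omega

/-- The terms not local to a node are redistributed: requests and children each sum to at most one
copy of the total weight, giving `32 + 5 + 18 = 55`. The join's own factor 4 is absorbed by the 32.
-/
theorem sum_chargeBound_le (hQ : ∀ e, Q.src e ≠ Q.tgt e) (hH : H.EdgeDominated)
    (hC : t.Consistent Q H C) (q : ℕ) :
    ∑ n ∈ (t.localize Q.toDirGraph req).nodes,
        (t.localize Q.toDirGraph req).chargeBound (t.localBound Q H C req) q n ≤
      55 * ∑ p ∈ t.nodes, weight q (C p) := by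
  let R : List Bool → ℕ := fun p =>
    ∑ d ∈ t.requestsAt req p .source, weight q (t.localBound Q H C req d) +
      ∑ d ∈ t.requestsAt req p .target, weight q (t.localBound Q H C req d)
  let D : List Bool → ℕ := fun p => match t.subtree p with
    | some (join _ _) => weight q (C (p ++ [false])) + weight q (C (p ++ [true]))
    | _ => 0
  have hnode : ∀ p ∈ t.nodes, (∑ n ∈
      (match t.subtree p with
        | some (input _) => navigationStructure p
        | some (join _ _) => joinStructure p
        | none => ∅),
      (t.localize Q.toDirGraph req).chargeBound (t.localBound Q H C req) q n) ≤
      32 * weight q (C p) + 5 * R p + 18 * D p := by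
    intro p _
    rcases hp : t.subtree p with _ | e | ⟨l, r⟩
    · simp
    · have := sum_chargeBound_navigationStructure_le (req := req) hQ hH hC q hp
      exact this.trans (Nat.le_add_right _ _)
    · have := sum_chargeBound_joinStructure_le (Q := Q) (H := H) (C := C) (req := req) q hp
      have hD : D p = weight q (C (p ++ [false])) + weight q (C (p ++ [true])) := by
        simp [D, hp]
      rw [hD]
      refine this.trans ?_
      omega
  have hR : ∑ p ∈ t.nodes, R p ≤ ∑ p ∈ t.nodes, weight q (C p) := by
    refine (sum_requestsAt_le req fun d => weight q (t.localBound Q H C req d)).trans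
      (le_trans (Finset.sum_le_sum fun a ha => ?_) (sum_joinChildren_le fun p => weight q (C p)))
    obtain ⟨l, r, h⟩ := mem_joinChildren.1 ha
    exact weight_localBound_assignment_le q h a.2
  have hD : ∑ p ∈ t.nodes, D p ≤ ∑ p ∈ t.nodes, weight q (C p) :=
    sum_nodes_join_le fun p => weight q (C p)
  rw [sum_localize_nodes]
  refine (Finset.sum_le_sum hnode).trans ?_
  rw [Finset.sum_add_distrib, Finset.sum_add_distrib, ← Finset.mul_sum, ← Finset.mul_sum,
    ← Finset.mul_sum]
  omega

theorem sum_weight_eq (q : ℕ) :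
    ((∑ p ∈ t.nodes, weight q (C p) : ℕ) : ℝ) =
      t.totalMatches C * (t.averageMatchSize C + (q : ℝ)) := by
  have h : ∑ p ∈ t.nodes, weight q (C p) =
      (∑ p ∈ t.nodes, ∑ᶠ m ∈ C p, m.size) + t.totalMatches C * q := by
    simp only [weight_eq, Finset.sum_add_distrib, totalMatches, Finset.sum_mul]
  rw [h, averageMatchSize]
  -- If `T = 0`, division gives average 0; all result sets are then empty, so the sum of sizes
  -- vanishes too.
  by_cases hT : t.totalMatches C = 0
  · have hzero : ∑ p ∈ t.nodes, ∑ᶠ m ∈ C p, m.size = 0 := by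
      refine Finset.sum_eq_zero fun p hp => ?_
      have h1 : (C p).ncard = 0 := Finset.sum_eq_zero_iff.1 hT p hp
      rw [(Set.ncard_eq_zero (Set.toFinite _)).1 h1]
      exact finsum_mem_empty
    simp [hT, hzero]
  · have : (t.totalMatches C : ℝ) ≠ 0 := by exact_mod_cast hT
    push_cast
    field_simp

end JoinTree

end Rete

-- The main theorem

universe u₁ u₂ u₃ u₄ u₅ u₆

open Rete in
theorem theorem4 :
    ∃ K : ℝ, ∀ {TV : Type u₁} {TE : Type u₂} {VQ : Type u₃} {EQ : Type u₄} {VH : Type u₅}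
      {EH : Type u₆} [Finite VQ] [Finite EQ] [Finite VH] [Finite EH] {TG : DirGraph TV TE}
      (Q : TypedGraph TG VQ EQ) (H : TypedGraph TG VH EH) (Hp : Subgraph H.toDirGraph)
      (t : JoinTree EQ) (C : List Bool → Set (PMap VQ EQ VH EH))
      (req : List Bool → Bool → Request VQ) (sort : List Bool → List LocalNode),
      (∀ e, Q.src e ≠ Q.tgt e) →
      H.EdgeDominated →
      t.WellFormed Q.toDirGraph →
      t.query Q.toDirGraph = ⊤ →
      t.Consistent Q H C →
      t.ValidRequests Q.toDirGraph req →
      (∀ p e, t.subtree p = some (JoinTree.input e) →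
        (t.localize Q.toDirGraph req).IsReverseToposort
          (JoinTree.navigationStructure p) (sort p)) →
      ((t.localize Q.toDirGraph req).run H Hp (t.order sort [])).config
          = (t.localize Q.toDirGraph req).execute H Hp (t.order sort []) (fun _ => ∅) ∧
      (((t.localize Q.toDirGraph req).run H Hp (t.order sort [])).steps : ℝ)
          ≤ K * (t.totalMatches C *
              (t.averageMatchSize C + ((Nat.card VQ + Nat.card EQ : ℕ) : ℝ))) := by
  refine ⟨55, ?_⟩
  intro TV TE VQ EQ VH EH _ _ _ _ TG Q H Hp t C req sort hQ hH hwf htop hC hreq hsort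
  have hB := JoinTree.localize_bounds (Hp := Hp) hC hreq
  have hroot : t.subtree [] = some t := by cases t <;> rfl
  obtain ⟨hs, hconfig, hsteps⟩ := MarkingNet.run_spec hB (t.order sort [])
    fun n hn => JoinTree.mem_nodes_of_mem_order hsort hroot hn
  refine ⟨hconfig, ?_⟩
  -- The number of markings `0, …, h, ∞` is `h + 2`. Bounding it by the size of the query graph lets
  -- `q = |Q|` pay for all raises of a match.
  have hq : t.height + 2 ≤ Nat.card VQ + Nat.card EQ := by
    have h := JoinTree.height_add_three_le hQ hwf
    rw [htop] at h
    change t.height + 3 ≤ (Set.univ : Set VQ).ncard + (Set.univ : Set EQ).ncard at h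
    rw [Set.ncard_univ, Set.ncard_univ] at h
    omega
  rw [← JoinTree.sum_weight_eq]
  exact_mod_cast hsteps.trans
    ((Finset.sum_le_sum fun n _ => MarkingNet.nodeCharge_le hB hs hq n).trans
      (JoinTree.sum_chargeBound_le hQ hH hC _))
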